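/- Let $m>0$ and let $D_m=i\alpha\partial_x+\beta m$, with $\alpha=\begin{pmatrix}-1&0\\0&1\end{pmatrix}$ and $\beta=\begin{pmatrix}0&1\\1&0\end{pmatrix}$, be the free one-dimensional Dirac operator on $L^2(\mathbb R;\mathbb C^2)$ with domain $H^1(\mathbb R;\mathbb C^2)$. Write $\langle x\rangle=(1+|x|^2)^{1/2}$. Let $V:\mathbb R\to\mathbb C^{2\times 2}$ be a matrix potential, not necessarily self-adjoint, with continuous entries such that for some $\epsilon>0$ and $C<\infty$ one has $|V_{ij}(x)|\le C\langle x\rangle^{-1-\epsilon}$ for all $x\in\mathbb R$ and all $i,j$, and let $H=D_m+V$, with domain $H^1(\mathbb R;\mathbb C^2)$. Then for every $\sigma>\frac12$ there are $\lambda_1\in(m,\infty)$ and $\delta>0$, depending on $V$, $m$ and $\sigma$, such that every $\lambda+i\gamma$ with $\lambda,\gamma\in\mathbb R$, $|\lambda|>\lambda_1$ and $0<|\gamma|<\delta|\lambda|$ lies in the resolvent set of $H$, and $$\sup_{\substack{|\lambda|>\lambda_1\\ 0<|\gamma|<\delta|\lambda|}}\big\|\langle x\rangle^{-\sigma}\,(H-(\lambda+i\gamma))^{-1}\,\langle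 x\rangle^{-\sigma}\big\|_{L^2\to L^2}<\infty .$$ Moreover, there is a compact set $K\subset\mathbb C$ such that every point of the spectrum of $H$ outside $K$ is real. -/

import Mathlib

noncomputable section

namespace Dirac1D

open MeasureTheory
open scoped ENNReal SchwartzMap LineDeriv

/-- `ℂ²` with its Hermitian norm. -/
abbrev Spinor : Type := EuclideanSpace ℂ (Fin 2)

/-- The Hilbert space `L²(ℝ; ℂ²)`. -/
abbrev SpinorL2 : Type := Lp Spinor 2 (volume : Measure ℝ)

/-- The Japanese bracket `⟨x⟩ = (1 + |x|²)^{1/2}`. -/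
def bracket (x : ℝ) : ℝ := Real.sqrt (1 + |x| ^ 2)

/-- `g ∈ L²` is the distributional derivative of `u ∈ L²`. -/
def HasDistribDeriv (u g : SpinorL2) : Prop :=
  ∂_{(1 : ℝ)} (u : 𝓢'(ℝ, Spinor)) = (g : 𝓢'(ℝ, Spinor))

lemma HasDistribDeriv.unique {u g h : SpinorL2} (hg : HasDistribDeriv u g)
    (hh : HasDistribDeriv u h) : g = h :=
  LinearMap.ker_eq_bot.1 (Lp.ker_toTemperedDistributionCLM_eq_bot
    (F := Spinor) (μ := (volume : Measure ℝ)) (p := 2)) (hg.symm.trans hh)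

lemma HasDistribDeriv.add {u v g h : SpinorL2} (hu : HasDistribDeriv u g)
    (hv : HasDistribDeriv v h) : HasDistribDeriv (u + v) (g + h) := by
  unfold HasDistribDeriv at *
  simp only [← Lp.toTemperedDistributionCLM_apply] at *
  rw [map_add, map_add, LineDeriv.lineDerivOp_add, hu, hv]

lemma HasDistribDeriv.smul {u g : SpinorL2} (c : ℂ) (hu : HasDistribDeriv u g) :
    HasDistribDeriv (c • u) (c • g) := by
  unfold HasDistribDeriv at *
  simp only [← Lp.toTemperedDistributionCLM_apply] at *
  rw [map_smul, map_smul, LineDeriv.lineDerivOp_smul, hu]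

lemma HasDistribDeriv.zero : HasDistribDeriv 0 0 := by
  simpa using (show HasDistribDeriv ((0 : ℂ) • 0) ((0 : ℂ) • 0) from by
    unfold HasDistribDeriv
    simp only [← Lp.toTemperedDistributionCLM_apply]
    rw [map_smul, LineDeriv.lineDerivOp_smul, zero_smul, zero_smul])

/-- The derivative `∂ₓ` on `L²(ℝ; ℂ²)`, with domain the Sobolev space `H¹(ℝ; ℂ²)`. -/
def derivOp : SpinorL2 →ₗ.[ℂ] SpinorL2 where
  domain :=
    { carrier := {u | ∃ g, HasDistribDeriv u g}
      add_mem' := fun ⟨g, hg⟩ ⟨h, hh⟩ => ⟨g + h, hg.add hh⟩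
      zero_mem' := ⟨0, HasDistribDeriv.zero⟩
      smul_mem' := fun c _ ⟨g, hg⟩ => ⟨c • g, hg.smul c⟩ }
  toFun :=
    { toFun := fun u => u.2.choose
      map_add' := fun u v =>
        (u + v).2.choose_spec.unique (u.2.choose_spec.add v.2.choose_spec)
      map_smul' := fun c u => (c • u).2.choose_spec.unique (u.2.choose_spec.smul c) }

/-- The action of a constant matrix on `L²(ℝ; ℂ²)`. -/
def constMatrix (A : Matrix (Fin 2) (Fin 2) ℂ) : SpinorL2 →L[ℂ] SpinorL2 :=
  (Matrix.toEuclideanCLM (n := Fin 2) (𝕜 := ℂ) A).compLpL 2 (volume : Measure ℝ)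

/-- The matrix `α`. -/
def alpha : Matrix (Fin 2) (Fin 2) ℂ := !![-1, 0; 0, 1]

/-- The matrix `β`. -/
def beta : Matrix (Fin 2) (Fin 2) ℂ := !![0, 1; 1, 0]

/-- The free Dirac operator `D_m = i α ∂ₓ + m β` with domain `H¹(ℝ; ℂ²)`. -/
def freeDirac (m : ℝ) : SpinorL2 →ₗ.[ℂ] SpinorL2 :=
  ((m : ℂ) • constMatrix beta).toLinearMap +ᵥ
    (Complex.I • constMatrix alpha).toLinearMap.compPMap derivOp

/-- The pointwise product `x ↦ V(x) u(x)` of a matrix function and a spinor field. -/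
def mulFun (V : ℝ → Matrix (Fin 2) (Fin 2) ℂ) (u : SpinorL2) : ℝ → Spinor :=
  fun x => Matrix.toEuclideanCLM (n := Fin 2) (𝕜 := ℂ) (V x) (u x)

lemma mulFun_add (V : ℝ → Matrix (Fin 2) (Fin 2) ℂ) (u v : SpinorL2) :
    mulFun V (u + v) =ᵐ[volume] mulFun V u + mulFun V v := by
  filter_upwards [Lp.coeFn_add u v] with x hx
  simp only [mulFun, Pi.add_apply, hx, map_add]

lemma mulFun_smul (V : ℝ → Matrix (Fin 2) (Fin 2) ℂ) (c : ℂ) (u : SpinorL2) :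
    mulFun V (c • u) =ᵐ[volume] c • mulFun V u := by
  filter_upwards [Lp.coeFn_smul c u] with x hx
  simp only [mulFun, Pi.smul_apply, hx, map_smul]

lemma mulFun_zero (V : ℝ → Matrix (Fin 2) (Fin 2) ℂ) :
    mulFun V 0 =ᵐ[volume] (0 : ℝ → Spinor) := by
  filter_upwards [Lp.coeFn_zero Spinor 2 (volume : Measure ℝ)] with x hx
  simp only [mulFun, hx, Pi.zero_apply, map_zero]

/-- Multiplication by the matrix function `V`, on its maximal domain `{u ∈ L² : V u ∈ L²}`. -/
def mulOp (V : ℝ → Matrix (Fin 2) (Fin 2) ℂ) : SpinorL2 →ₗ.[ℂ] SpinorL2 where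
  domain :=
    { carrier := {u | MemLp (mulFun V u) 2 volume}
      add_mem' := fun {u v} hu hv => (memLp_congr_ae (mulFun_add V u v)).2 (hu.add hv)
      zero_mem' := (memLp_congr_ae (mulFun_zero V)).2 MemLp.zero
      smul_mem' := fun c u hu => (memLp_congr_ae (mulFun_smul V c u)).2 (hu.const_smul c) }
  toFun :=
    { toFun := fun u => MemLp.toLp (mulFun V u) u.2
      map_add' := fun u v => by
        rw [← MemLp.toLp_add]
        exact (MemLp.toLp_eq_toLp_iff _ _).2 (mulFun_add V u v)
      map_smul' := fun c u => by
        rw [RingHom.id_apply, ← MemLp.toLp_const_smul]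
        exact (MemLp.toLp_eq_toLp_iff _ _).2 (mulFun_smul V c u) }

/-- The perturbed Dirac operator `H = D_m + V`, with domain the intersection of the two domains;
for bounded measurable `V` this is `H¹(ℝ; ℂ²)`. -/
def dirac (m : ℝ) (V : ℝ → Matrix (Fin 2) (Fin 2) ℂ) : SpinorL2 →ₗ.[ℂ] SpinorL2 :=
  freeDirac m + mulOp V

/-- The bounded operator `R` is the resolvent `(A - z)⁻¹` of the unbounded operator `A`. -/
structure IsResolvent {E : Type*} [NormedAddCommGroup E] [NormedSpace ℂ E]
    (A : E →ₗ.[ℂ] E) (z : ℂ) (R : E →L[ℂ] E) : Prop where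
  mem_domain : ∀ f, R f ∈ A.domain
  right_inv : ∀ f, A ⟨R f, mem_domain f⟩ - z • R f = f
  left_inv : ∀ u : A.domain, R (A u - z • (u : E)) = u

/-- The resolvent set of an unbounded operator. -/
def resolventSet {E : Type*} [NormedAddCommGroup E] [NormedSpace ℂ E]
    (A : E →ₗ.[ℂ] E) : Set ℂ :=
  {z | ∃ R : E →L[ℂ] E, IsResolvent A z R}

/-- The spectrum of an unbounded operator. -/
def unboundedSpectrum {E : Type*} [NormedAddCommGroup E] [NormedSpace ℂ E]
    (A : E →ₗ.[ℂ] E) : Set ℂ :=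
  (resolventSet A)ᶜ

lemma one_le_bracket (x : ℝ) : 1 ≤ bracket x :=
  Real.one_le_sqrt.2 (by nlinarith [sq_nonneg |x|])

lemma memLp_weight (σ : ℝ) (hσ : 0 ≤ σ) :
    MemLp (fun x : ℝ => ((bracket x ^ (-σ) : ℝ) : ℂ)) ∞ volume := by
  refine memLp_top_of_bound ?_ 1 (Filter.Eventually.of_forall fun x => ?_)
  · refine Measurable.aestronglyMeasurable ?_
    unfold bracket
    fun_prop
  · have h := one_le_bracket x
    rw [Complex.norm_real, Real.norm_of_nonneg (by positivity)]
    exact Real.rpow_le_one_of_one_le_of_nonpos h (by linarith)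

/-- Multiplication by `⟨x⟩^{-σ}`, `σ ≥ 0`, as a bounded operator on `L²(ℝ; ℂ²)`. -/
def weight (σ : ℝ) (hσ : 0 ≤ σ) : SpinorL2 →L[ℂ] SpinorL2 :=
  (ContinuousLinearMap.lsmul ℂ ℂ (E := Spinor)).holderL (volume : Measure ℝ) ∞ 2 2
    (memLp_weight σ hσ).toLp

end Dirac1D

end

/-
With `k² = z² - m²`, a constant change of unknowns `y = P u` turns `(D_m - z) u = f` into two
decoupled equations `y' = ± i k y + …`, damped at rate at least `|Im z|`. Approximate `V` in `L¹` by
a regular potential `W` and treat `(V - W) u` as a source of small mass. Integrating factors remove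
the diagonal of the transformed `W`; its entry `W₀₁` couples components that oscillate with opposite
frequencies, so after subtracting the corrector `Ψ y₁`, `Ψ = -W₀₁ / (2 i k)`, only a coupling of
size `O(1 / |k|)` is left. Hence `sup |u| ≤ C ∫ |f|` with `C` independent of `z`, for all large
non-real `z`. As `⟨x⟩^{-σ}` lies in `L²` when `σ > 1 / 2`, this is the weighted estimate.

With an `L²` source in place of an integrable one, the same argument bounds `H - z` from below, and
likewise its formal adjoint, which has the potential `V*`: hence `H - z` has closed, dense range.
-/

noncomputable section

namespace Dirac1D

open MeasureTheory Filter Topology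
open scoped ENNReal SchwartzMap LineDeriv Matrix.Norms.L2Operator

local notation "𝓜" => Matrix.toEuclideanCLM (n := Fin 2) (𝕜 := ℂ)

/-! ### Damped first-order equations -/

section SquareIntegrable

variable {α E F : Type*} [MeasurableSpace α] {μ : Measure α} [NormedAddCommGroup E]
  [NormedAddCommGroup F]

lemma toReal_eLpNorm_two {f : α → E} (hf : MemLp f 2 μ) :
    (eLpNorm f 2 μ).toReal = √(∫ x, ‖f x‖ ^ 2 ∂μ) := by
  rw [hf.eLpNorm_eq_integral_rpow_norm two_ne_zero ENNReal.ofNat_ne_top,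
    ENNReal.toReal_ofReal (by positivity), Real.sqrt_eq_rpow]
  simp

lemma integral_norm_mul_norm_le {f : α → E} {g : α → F} (hf : MemLp f 2 μ) (hg : MemLp g 2 μ) :
    ∫ x, ‖f x‖ * ‖g x‖ ∂μ ≤ (eLpNorm f 2 μ).toReal * (eLpNorm g 2 μ).toReal := by
  have h := integral_mul_norm_le_Lp_mul_Lq Real.HolderConjugate.two_two
    (f := fun x => ‖f x‖) (g := fun x => ‖g x‖) (by simpa using hf.norm) (by simpa using hg.norm)
  simpa only [norm_norm, toReal_eLpNorm_two hf, toReal_eLpNorm_two hg, Real.sqrt_eq_rpow,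
    Real.rpow_two] using h

lemma memLp_two_of_integrable_of_memLp_top {f : α → E} (h₁ : Integrable f μ) (h : MemLp f ∞ μ) :
    MemLp f 2 μ := by
  refine (memLp_two_iff_integrable_sq_norm h₁.1).2 ?_
  simpa only [sq] using
    memLp_one_iff_integrable.1 ((memLp_one_iff_integrable.2 h₁.norm).mul' h.norm)

end SquareIntegrable

section Damped

variable {E F : Type*} [NormedAddCommGroup E] [NormedSpace ℝ E] [NormedAddCommGroup F]
  [NormedSpace ℝ F] {κ κ' N N' : ℝ} {g h : ℝ → E}

/-- The source `g` has size at most `N` for equations with damping rate `κ`: its integral against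
the kernel `exp (-κ |x - s|)` is absolutely convergent and bounded by `N`, uniformly in `x`. -/
structure HasDampedBound (κ : ℝ) (g : ℝ → E) (N : ℝ) : Prop where
  integrable : ∀ x, Integrable fun s => Real.exp (-κ * |x - s|) • g s
  integral_le : ∀ x, ∫ s, Real.exp (-κ * |x - s|) * ‖g s‖ ≤ N

namespace HasDampedBound

lemma integrable_norm (hg : HasDampedBound κ g N) (x : ℝ) :
    Integrable fun s => Real.exp (-κ * |x - s|) * ‖g s‖ := by
  simpa only [norm_smul, Real.norm_eq_abs, Real.abs_exp] using (hg.integrable x).norm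

lemma nonneg (hg : HasDampedBound κ g N) : 0 ≤ N :=
  (integral_nonneg fun _ => by positivity).trans (hg.integral_le 0)

lemma aestronglyMeasurable (hg : HasDampedBound κ g N) : AEStronglyMeasurable g := by
  have hfactor : g = fun s => Real.exp (κ * |0 - s|) • Real.exp (-κ * |0 - s|) • g s := by
    funext s
    rw [smul_smul, ← Real.exp_add]
    simp
  rw [hfactor]
  exact (Continuous.aestronglyMeasurable (by fun_prop)).smul (hg.integrable 0).1

lemma add (hg : HasDampedBound κ g N) (hh : HasDampedBound κ h N') :
    HasDampedBound κ (fun x => g x + h x) (N + N') where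
  integrable x := by
    simp only [smul_add]
    exact (hg.integrable x).add (hh.integrable x)
  integral_le x := by
    refine le_trans ?_ (add_le_add (hg.integral_le x) (hh.integral_le x))
    rw [← integral_add (hg.integrable_norm x) (hh.integrable_norm x)]
    refine integral_mono_of_nonneg (.of_forall fun _ => by positivity)
      ((hg.integrable_norm x).add (hh.integrable_norm x)) (.of_forall fun s => ?_)
    simp only [← mul_add]
    gcongr
    exact norm_add_le _ _

lemma of_norm_le {f : ℝ → F} {c : ℝ} (hg : HasDampedBound κ g N)
    (hf : AEStronglyMeasurable f) (hc : 0 ≤ c) (hfg : ∀ᵐ x, ‖f x‖ ≤ c * ‖g x‖) :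
    HasDampedBound κ f (c * N) := by
  have hle : ∀ x, ∀ᵐ s,
      Real.exp (-κ * |x - s|) * ‖f s‖ ≤ c * (Real.exp (-κ * |x - s|) * ‖g s‖) := fun x => by
    filter_upwards [hfg] with s hs
    rw [mul_left_comm]
    gcongr
  refine ⟨fun x => ((hg.integrable_norm x).const_mul c).mono' ?_ ?_, fun x => ?_⟩
  · exact (Continuous.aestronglyMeasurable (by fun_prop)).smul hf
  · simpa only [norm_smul, Real.norm_eq_abs, Real.abs_exp] using hle x
  · calc ∫ s, Real.exp (-κ * |x - s|) * ‖f s‖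
        ≤ ∫ s, c * (Real.exp (-κ * |x - s|) * ‖g s‖) :=
          integral_mono_of_nonneg (.of_forall fun _ => by positivity)
            ((hg.integrable_norm x).const_mul c) (hle x)
      _ ≤ c * N := by
          rw [integral_const_mul]
          gcongr
          exact hg.integral_le x

lemma neg (hg : HasDampedBound κ g N) : HasDampedBound κ (fun x => -g x) N := by
  simpa only [one_mul] using hg.of_norm_le (f := fun x => -g x) hg.aestronglyMeasurable.neg
    zero_le_one (.of_forall fun x => by rw [norm_neg, one_mul])

lemma mono (hg : HasDampedBound κ g N) (hN : N ≤ N') : HasDampedBound κ g N' :=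
  ⟨hg.integrable, fun x => (hg.integral_le x).trans hN⟩

lemma anti (hg : HasDampedBound κ g N) (hκ : κ ≤ κ') : HasDampedBound κ' g N := by
  have hexp : ∀ x s : ℝ, Real.exp (-κ' * |x - s|) ≤ Real.exp (-κ * |x - s|) := fun x s => by
    gcongr
  have hfactor : ∀ x s : ℝ, Real.exp (-κ' * |x - s|) • g s
      = Real.exp ((κ - κ') * |x - s|) • Real.exp (-κ * |x - s|) • g s := fun x s => by
    rw [smul_smul, ← Real.exp_add]
    ring_nf
  refine ⟨fun x => (hg.integrable x).mono ?_ (.of_forall fun s => ?_), fun x => ?_⟩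
  · simp only [hfactor]
    exact (Continuous.aestronglyMeasurable (by fun_prop)).smul (hg.integrable x).1
  · simp only [norm_smul, Real.norm_eq_abs, Real.abs_exp]
    exact mul_le_mul_of_nonneg_right (hexp x s) (norm_nonneg _)
  · refine le_trans (integral_mono_of_nonneg (.of_forall fun _ => by positivity)
      (hg.integrable_norm x) (.of_forall fun s => ?_)) (hg.integral_le x)
    exact mul_le_mul_of_nonneg_right (hexp x s) (norm_nonneg _)

lemma of_integrable (hκ : 0 ≤ κ) (hg : Integrable g) : HasDampedBound κ g (∫ x, ‖g x‖) := by
  have hexp : ∀ x s : ℝ, Real.exp (-κ * |x - s|) ≤ 1 := fun x s =>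
    Real.exp_le_one_iff.2 (mul_nonpos_of_nonpos_of_nonneg (neg_nonpos.2 hκ) (abs_nonneg _))
  refine ⟨fun x => hg.mono ?_ (.of_forall fun s => ?_), fun x => ?_⟩
  · exact (Continuous.aestronglyMeasurable (by fun_prop)).smul hg.1
  · rw [norm_smul, Real.norm_eq_abs, Real.abs_exp]
    exact mul_le_of_le_one_left (norm_nonneg _) (hexp x s)
  · exact integral_mono_of_nonneg (.of_forall fun _ => by positivity) hg.norm
      (.of_forall fun s => mul_le_of_le_one_left (norm_nonneg _) (hexp x s))

lemma comp_neg (hg : HasDampedBound κ g N) : HasDampedBound κ (fun x => g (-x)) N := by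
  have habs : ∀ x s : ℝ, |x - s| = |-x - -s| := fun x s => by rw [neg_sub_neg, abs_sub_comm]
  refine ⟨fun x => ?_, fun x => ?_⟩
  · simpa only [habs x] using (hg.integrable (-x)).comp_neg
  · simp only [habs x]
    rw [integral_neg_eq_self fun s => Real.exp (-κ * |-x - s|) * ‖g s‖]
    exact hg.integral_le (-x)

end HasDampedBound

lemma integral_exp_neg_mul_abs (hκ : 0 < κ) : ∫ s : ℝ, Real.exp (-κ * |s|) = 2 / κ := by
  rw [integral_comp_abs (f := fun s => Real.exp (-κ * s)), integral_exp_mul_Ioi (by linarith)]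
  simp only [mul_zero, Real.exp_zero]
  ring

lemma integrable_exp_neg_mul_abs (hκ : 0 < κ) : Integrable fun s : ℝ => Real.exp (-κ * |s|) :=
  .of_integral_ne_zero (by rw [integral_exp_neg_mul_abs hκ]; positivity)

lemma memLp_two_exp_neg_mul_abs (hκ : 0 < κ) (x : ℝ) :
    MemLp (fun s : ℝ => Real.exp (-κ * |x - s|)) 2 ∧
      (eLpNorm (fun s : ℝ => Real.exp (-κ * |x - s|)) 2 volume).toReal = 1 / √κ := by
  have hsq : ∀ s : ℝ, Real.exp (-κ * |x - s|) ^ 2 = Real.exp (-(2 * κ) * |x - s|) := fun s => by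
    rw [← Real.exp_nat_mul]
    ring_nf
  have hmem : MemLp (fun s : ℝ => Real.exp (-κ * |x - s|)) 2 := by
    refine (memLp_two_iff_integrable_sq (Continuous.aestronglyMeasurable (by fun_prop))).2 ?_
    simp only [hsq]
    exact (integrable_exp_neg_mul_abs (by positivity)).comp_sub_left x
  refine ⟨hmem, ?_⟩
  rw [toReal_eLpNorm_two hmem]
  simp only [Real.norm_eq_abs, Real.abs_exp, hsq]
  rw [integral_sub_left_eq_self (fun s => Real.exp (-(2 * κ) * |s|)),
    integral_exp_neg_mul_abs (by positivity), one_div, ← Real.sqrt_inv]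
  field_simp

lemma HasDampedBound.of_memLp_two (hκ : 0 < κ) (hg : MemLp g 2) :
    HasDampedBound κ g ((eLpNorm g 2 volume).toReal / √κ) := by
  refine ⟨fun x => ?_, fun x => ?_⟩
  · exact memLp_one_iff_integrable.1 (hg.smul (memLp_two_exp_neg_mul_abs hκ x).1)
  · have h := integral_norm_mul_norm_le (memLp_two_exp_neg_mul_abs hκ x).1 hg
    rw [(memLp_two_exp_neg_mul_abs hκ x).2] at h
    simp only [Real.norm_eq_abs, Real.abs_exp] at h
    rwa [div_eq_inv_mul, ← one_div]

end Damped

section Scalar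

variable {k : ℂ} {a g y : ℝ → ℂ} {N : ℝ}

lemma hasDerivAt_integratingFactor (k : ℂ) (ha : Continuous a) (x s : ℝ) :
    HasDerivAt (fun s : ℝ => Complex.exp (Complex.I * k * (x - s) + ∫ t in s..x, a t))
      (-(Complex.I * k + a s) * Complex.exp (Complex.I * k * (x - s) + ∫ t in s..x, a t)) s := by
  have hint : HasDerivAt (fun s : ℝ => ∫ t in s..x, a t) (-a s) s :=
    intervalIntegral.integral_hasDerivAt_left (ha.intervalIntegrable _ _)
      (ha.stronglyMeasurableAtFilter _ _) ha.continuousAt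
  have hlin : HasDerivAt (fun s : ℝ => Complex.I * k * ((x : ℂ) - s)) (Complex.I * k * (0 - 1)) s :=
    ((hasDerivAt_const s (x : ℂ)).sub (hasDerivAt_id s).ofReal_comp).const_mul _
  refine (hlin.add hint).cexp.congr_deriv ?_
  rw [Pi.add_apply]
  ring

lemma norm_integratingFactor_le (k : ℂ) (hai : Integrable a) {x s : ℝ} (hs : s ≤ x) :
    ‖Complex.exp (Complex.I * k * (x - s) + ∫ t in s..x, a t)‖
      ≤ Real.exp (∫ t, ‖a t‖) * Real.exp (-k.im * |x - s|) := by
  have hint : ‖∫ t in s..x, a t‖ ≤ ∫ t, ‖a t‖ :=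
    intervalIntegral.norm_integral_le_integral_norm_uIoc.trans
      (setIntegral_le_integral hai.norm (.of_forall fun _ => norm_nonneg _))
  have hre : (Complex.I * k * ((x : ℂ) - s)).re = -k.im * |x - s| := by
    rw [abs_of_nonneg (sub_nonneg.2 hs), ← Complex.ofReal_sub, Complex.re_mul_ofReal]
    simp
  rw [Complex.norm_exp, ← Real.exp_add, Complex.add_re, hre, add_comm]
  gcongr
  exact (Complex.re_le_norm _).trans hint

lemma norm_le_of_hasDerivAt_damped_of_le (ha : Continuous a) (hai : Integrable a)
    (hg : HasDampedBound k.im g N) (hy : ∀ x, HasDerivAt y ((Complex.I * k + a x) * y x + g x) x)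
    {r x : ℝ} (hr : r ≤ x) :
    ‖y x‖ ≤ Real.exp (∫ t, ‖a t‖) * (Real.exp (-k.im * |x - r|) * ‖y r‖ + N) := by
  set M := ∫ t, ‖a t‖
  set e : ℝ → ℂ := fun s => Complex.exp (Complex.I * k * (x - s) + ∫ t in s..x, a t)
  have he : Continuous e :=
    continuous_iff_continuousAt.2 fun s => (hasDerivAt_integratingFactor k ha x s).continuousAt
  have hgi : IntervalIntegrable (fun s => e s * g s) volume r x := by
    have hfactor : (fun s => e s * g s) = fun s =>
        (e s * Real.exp (k.im * |x - s|)) * (Real.exp (-k.im * |x - s|) • g s) := by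
      funext s
      rw [Complex.real_smul, mul_assoc, ← mul_assoc (Complex.ofReal _), ← Complex.ofReal_mul,
        ← Real.exp_add]
      simp
    rw [hfactor]
    exact (hg.integrable x).intervalIntegrable.continuousOn_mul (by fun_prop)
  have hduhamel : y x = e r * y r + ∫ s in r..x, e s * g s := by
    have hex : e x = 1 := by simp [e]
    have hderiv : ∀ s, HasDerivAt (fun s => e s * y s) (e s * g s) s := fun s =>
      ((hasDerivAt_integratingFactor k ha x s).mul (hy s)).congr_deriv (by ring)
    rw [intervalIntegral.integral_eq_sub_of_hasDerivAt (fun s _ => hderiv s) hgi, hex]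
    ring
  have hsource : ‖∫ s in r..x, e s * g s‖ ≤ Real.exp M * N := by
    calc ‖∫ s in r..x, e s * g s‖
        ≤ ∫ s in Set.Ioc r x, ‖e s * g s‖ := by
          rw [intervalIntegral.integral_of_le hr]
          exact norm_integral_le_integral_norm _
      _ ≤ ∫ s in Set.Ioc r x, Real.exp M * (Real.exp (-k.im * |x - s|) * ‖g s‖) := by
          refine setIntegral_mono_on hgi.1.norm
            ((hg.integrable_norm x).const_mul _).integrableOn measurableSet_Ioc fun s hs => ?_
          rw [norm_mul, ← mul_assoc]
          gcongr
          exact norm_integratingFactor_le k hai hs.2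
      _ ≤ ∫ s, Real.exp M * (Real.exp (-k.im * |x - s|) * ‖g s‖) :=
          setIntegral_le_integral ((hg.integrable_norm x).const_mul _)
            (.of_forall fun _ => by positivity)
      _ ≤ Real.exp M * N := by
          rw [integral_const_mul]
          gcongr
          exact hg.integral_le x
  rw [hduhamel, mul_add]
  refine (norm_add_le _ _).trans (add_le_add ?_ hsource)
  rw [norm_mul, ← mul_assoc]
  gcongr
  exact norm_integratingFactor_le k hai hr

/-- A bounded solution has no boundary term at `-∞`. -/
lemma norm_le_of_hasDerivAt_damped (hk : 0 < k.im) (ha : Continuous a) (hai : Integrable a)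
    (hg : HasDampedBound k.im g N) {b : ℝ} (hb : ∀ x, ‖y x‖ ≤ b)
    (hy : ∀ x, HasDerivAt y ((Complex.I * k + a x) * y x + g x) x) (x : ℝ) :
    ‖y x‖ ≤ Real.exp (∫ t, ‖a t‖) * N := by
  have hlim : Tendsto (fun r => Real.exp (∫ t, ‖a t‖) * (Real.exp (-k.im * |x - r|) * b + N)) atBot
      (𝓝 (Real.exp (∫ t, ‖a t‖) * (0 * b + N))) := by
    have habs : Tendsto (fun r : ℝ => |x - r|) atBot atTop :=
      tendsto_abs_atTop_atTop.comp (tendsto_atTop_add_const_left _ x tendsto_neg_atBot_atTop)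
    have hexp := Real.tendsto_exp_atBot.comp
      (habs.const_mul_atTop_of_neg (neg_lt_zero.2 hk))
    exact ((hexp.mul_const b).add_const N).const_mul _
  rw [zero_mul, zero_add] at hlim
  refine ge_of_tendsto hlim ((eventually_le_atBot x).mono fun r hr => ?_)
  refine (norm_le_of_hasDerivAt_damped_of_le ha hai hg hy hr).trans ?_
  gcongr
  exact hb r

lemma norm_le_of_hasDerivAt_antidamped (hk : 0 < k.im) (ha : Continuous a) (hai : Integrable a)
    (hg : HasDampedBound k.im g N) {b : ℝ} (hb : ∀ x, ‖y x‖ ≤ b)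
    (hy : ∀ x, HasDerivAt y ((-(Complex.I * k) + a x) * y x + g x) x) (x : ℝ) :
    ‖y x‖ ≤ Real.exp (∫ t, ‖a t‖) * N := by
  have hreflect : ∀ x, HasDerivAt (fun x => y (-x))
      ((Complex.I * k + -a (-x)) * y (-x) + -g (-x)) x := fun x =>
    ((hy (-x)).scomp x (hasDerivAt_neg x)).congr_deriv (by simp; ring)
  have h := norm_le_of_hasDerivAt_damped hk (a := fun x => -a (-x)) (by fun_prop)
    hai.comp_neg.neg hg.comp_neg.neg (fun x => hb (-x)) hreflect (-x)
  simpa only [norm_neg, neg_neg, integral_neg_eq_self fun t => ‖a t‖] using h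

end Scalar

/-! ### Diagonal systems with a small oscillating coupling -/

lemma norm_entry_le (A : Matrix (Fin 2) (Fin 2) ℂ) (i j : Fin 2) : ‖A i j‖ ≤ ‖A‖ := by
  have hentry : A i j = 𝓜 A (EuclideanSpace.single j 1) i := by
    simp [Matrix.ofLp_toEuclideanCLM]
  rw [hentry]
  refine (PiLp.norm_apply_le _ i).trans (((𝓜 A).le_opNorm _).trans ?_)
  simp [Matrix.cstar_norm_def]

lemma norm_le_norm_add_norm (v : Spinor) : ‖v‖ ≤ ‖v 0‖ + ‖v 1‖ := by
  rw [EuclideanSpace.norm_eq, Fin.sum_univ_two]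
  exact Real.sqrt_le_iff.2 ⟨by positivity, by nlinarith [norm_nonneg (v 0), norm_nonneg (v 1)]⟩

/-- `W` is a differentiable matrix potential of mass `∫ ‖W‖` at most `M`, such that both `‖W‖` and
the total variation `∫ ‖W'‖` are at most `B`. -/
structure IsRegularPotential (W : ℝ → Matrix (Fin 2) (Fin 2) ℂ) (M B : ℝ) : Prop where
  differentiable : Differentiable ℝ W
  integrable : Integrable W
  integral_norm_le : ∫ x, ‖W x‖ ≤ M
  norm_le : ∀ x, ‖W x‖ ≤ B
  integrable_deriv : Integrable (deriv W)
  integral_norm_deriv_le : ∫ x, ‖deriv W x‖ ≤ B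

section System

variable {W : ℝ → Matrix (Fin 2) (Fin 2) ℂ} {k : ℂ} {y G : ℝ → Spinor} {M B θ S N : ℝ}

namespace IsRegularPotential

lemma mass_nonneg (hW : IsRegularPotential W M B) : 0 ≤ M :=
  (integral_nonneg fun _ => norm_nonneg _).trans hW.integral_norm_le

lemma continuous_entry (hW : IsRegularPotential W M B) (i j : Fin 2) :
    Continuous fun x => W x i j :=
  hW.differentiable.continuous.matrix_elem i j

lemma integrable_entry (hW : IsRegularPotential W M B) (i j : Fin 2) :
    Integrable fun x => W x i j :=
  hW.integrable.mono (hW.continuous_entry i j).aestronglyMeasurable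
    (.of_forall fun x => norm_entry_le (W x) i j)

lemma integral_norm_entry_le (hW : IsRegularPotential W M B) (i j : Fin 2) :
    ∫ x, ‖W x i j‖ ≤ M :=
  (integral_mono (hW.integrable_entry i j).norm hW.integrable.norm
    fun x => norm_entry_le (W x) i j).trans hW.integral_norm_le

lemma hasDerivAt_entry (hW : IsRegularPotential W M B) (i j : Fin 2) (x : ℝ) :
    HasDerivAt (fun x => W x i j) (deriv W x i j) x :=
  (Matrix.entryLinearMap ℝ ℂ i j).toContinuousLinearMap.hasFDerivAt.comp_hasDerivAt x
    (hW.differentiable x).hasDerivAt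

lemma aestronglyMeasurable_deriv_entry (hW : IsRegularPotential W M B) (i j : Fin 2) :
    AEStronglyMeasurable fun x => deriv W x i j :=
  (Matrix.entryLinearMap ℝ ℂ i j).toContinuousLinearMap.continuous.comp_aestronglyMeasurable
    hW.integrable_deriv.1

end IsRegularPotential

lemma hasDerivAt_components {A : Matrix (Fin 2) (Fin 2) ℂ} {v : Spinor} {x : ℝ}
    (hy : HasDerivAt y (𝓜 (-(Complex.I * k) • alpha + A) (y x) + v) x) :
    HasDerivAt (fun x => y x 0) ((Complex.I * k + A 0 0) * y x 0 + (A 0 1 * y x 1 + v 0)) x ∧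
    HasDerivAt (fun x => y x 1) ((-(Complex.I * k) + A 1 1) * y x 1 + (A 1 0 * y x 0 + v 1)) x := by
  have h := fun i : Fin 2 =>
    ((EuclideanSpace.proj i : Spinor →L[ℂ] ℂ).restrictScalars ℝ).hasFDerivAt.comp_hasDerivAt x hy
  refine ⟨(h 0).congr_deriv ?_, (h 1).congr_deriv ?_⟩ <;>
  · simp [Matrix.ofLp_toEuclideanCLM, Matrix.mulVec, dotProduct, alpha, Fin.sum_univ_two]
    ring

/-- The factor `Ψ` for which subtracting `Ψ y₁` from `y₀` removes the coupling `W₀₁` up to terms of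
order `1 / k`: since `y₀` and `y₁` oscillate with opposite frequencies, the leading contribution
`2 i k Ψ` of the commutator cancels `W₀₁`. -/
def corrector (k : ℂ) (W : ℝ → Matrix (Fin 2) (Fin 2) ℂ) (x : ℝ) : ℂ :=
  -W x 0 1 / (2 * Complex.I * k)

/-- The derivative of `corrector k W`. -/
def correctorDeriv (k : ℂ) (W : ℝ → Matrix (Fin 2) (Fin 2) ℂ) (x : ℝ) : ℂ :=
  -deriv W x 0 1 / (2 * Complex.I * k)

/-- The part of order `1 / k` of the source in the equation of `y₀ - Ψ y₁`. -/
def correctedSource (k : ℂ) (W : ℝ → Matrix (Fin 2) (Fin 2) ℂ) (y : ℝ → Spinor) (x : ℝ) : ℂ :=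
  ((W x 0 0 - W x 1 1) * corrector k W x - correctorDeriv k W x) * y x 1
    - corrector k W x * W x 1 0 * y x 0

lemma norm_neg_div_two_I_mul_le {w : ℂ} {b : ℝ} (hk : 0 < ‖k‖) (hw : ‖w‖ ≤ b) :
    ‖-w / (2 * Complex.I * k)‖ ≤ b / (2 * ‖k‖) := by
  simp only [norm_div, norm_neg, norm_mul, Complex.norm_I, Complex.norm_ofNat, mul_one]
  gcongr

lemma norm_corrector_le (hk : 0 < ‖k‖) (hW : IsRegularPotential W M B) (hθ : B ≤ θ * (2 * ‖k‖))
    (x : ℝ) : ‖corrector k W x‖ ≤ θ :=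
  (norm_neg_div_two_I_mul_le hk ((norm_entry_le _ _ _).trans (hW.norm_le x))).trans
    ((div_le_iff₀ (by positivity)).2 hθ)

lemma hasDerivAt_corrected (hk : k ≠ 0) (hW : IsRegularPotential W M B) {x : ℝ}
    (hy : HasDerivAt y (𝓜 (-(Complex.I * k) • alpha + W x) (y x) + G x) x) :
    HasDerivAt (fun x => y x 0 - corrector k W x * y x 1)
      ((Complex.I * k + W x 0 0) * (y x 0 - corrector k W x * y x 1)
        + (correctedSource k W y x + (G x 0 - corrector k W x * G x 1))) x := by
  obtain ⟨hy₀, hy₁⟩ := hasDerivAt_components hy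
  have hcorr : HasDerivAt (corrector k W) (correctorDeriv k W x) x :=
    (hW.hasDerivAt_entry 0 1 x).neg.div_const _
  have hcancel : W x 0 1 = -(2 * Complex.I * k) * corrector k W x := by
    have := Complex.I_ne_zero
    unfold corrector
    field_simp
  refine (hy₀.sub (hcorr.mul hy₁)).congr_deriv ?_
  rw [correctedSource, hcancel]
  ring

lemma continuous_corrector (hW : IsRegularPotential W M B) : Continuous (corrector k W) :=
  (hW.continuous_entry 0 1).neg.div_const _

lemma aestronglyMeasurable_correctedSource (hW : IsRegularPotential W M B) (hyc : Continuous y) :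
    AEStronglyMeasurable (correctedSource k W y) := by
  have h₀ : Continuous fun x => y x 0 := by fun_prop
  have h₁ : Continuous fun x => y x 1 := by fun_prop
  have hc := hW.continuous_entry
  have hΨ : Continuous (corrector k W) := continuous_corrector hW
  have hΨ' : AEStronglyMeasurable (correctorDeriv k W) := by
    unfold correctorDeriv
    simp only [div_eq_mul_inv]
    exact (hW.aestronglyMeasurable_deriv_entry 0 1).neg.mul_const _
  exact (((((hc 0 0).sub (hc 1 1)).mul hΨ).aestronglyMeasurable.sub hΨ').mul
    h₁.aestronglyMeasurable).sub ((hΨ.mul (hc 1 0)).mul h₀).aestronglyMeasurable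

lemma norm_correctedSource_le (hk : 0 < ‖k‖) (hW : IsRegularPotential W M B)
    (hθ : B ≤ θ * (2 * ‖k‖)) {x : ℝ} (hS : ‖y x‖ ≤ S) :
    ‖correctedSource k W y x‖ ≤ S * (3 * θ * ‖W x‖ + (2 * ‖k‖)⁻¹ * ‖deriv W x‖) := by
  have hy := fun i => (PiLp.norm_apply_le (y x) i).trans hS
  have hdiag : ‖W x 0 0 - W x 1 1‖ ≤ 2 * ‖W x‖ :=
    (norm_sub_le _ _).trans (by linarith [norm_entry_le (W x) 0 0, norm_entry_le (W x) 1 1])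
  have hderiv : ‖correctorDeriv k W x‖ ≤ (2 * ‖k‖)⁻¹ * ‖deriv W x‖ := by
    rw [← div_eq_inv_mul]
    exact norm_neg_div_two_I_mul_le hk (norm_entry_le _ _ _)
  have hcorr := norm_corrector_le hk hW hθ x
  have hθ₀ : 0 ≤ θ := (norm_nonneg _).trans hcorr
  have hoff := norm_entry_le (W x) 1 0
  calc ‖correctedSource k W y x‖
      ≤ (‖W x 0 0 - W x 1 1‖ * ‖corrector k W x‖ + ‖correctorDeriv k W x‖) * ‖y x 1‖
        + ‖corrector k W x‖ * ‖W x 1 0‖ * ‖y x 0‖ := by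
        refine (norm_sub_le _ _).trans ?_
        simp only [norm_mul]
        gcongr
        rw [← norm_mul]
        exact norm_sub_le _ _
    _ ≤ (2 * ‖W x‖ * θ + (2 * ‖k‖)⁻¹ * ‖deriv W x‖) * S + θ * ‖W x‖ * S := by
        gcongr
        exacts [hy 1, hy 0]
    _ = S * (3 * θ * ‖W x‖ + (2 * ‖k‖)⁻¹ * ‖deriv W x‖) := by ring

lemma hasDampedBound_correctedSource (hk : 0 < k.im) (hW : IsRegularPotential W M B)
    (hθ : B ≤ θ * (2 * ‖k‖)) (hyc : Continuous y) (hS : ∀ x, ‖y x‖ ≤ S) :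
    HasDampedBound k.im (correctedSource k W y) (θ * (3 * M + 1) * S) := by
  have hk₀ : 0 < ‖k‖ := norm_pos_iff.2 fun h => by simp [h] at hk
  have hS₀ : 0 ≤ S := (norm_nonneg _).trans (hS 0)
  have hθ₀ : 0 ≤ θ := (norm_nonneg _).trans (norm_corrector_le hk₀ hW hθ 0)
  set F : ℝ → ℝ := fun x => 3 * θ * ‖W x‖ + (2 * ‖k‖)⁻¹ * ‖deriv W x‖
  have hF : Integrable F :=
    (hW.integrable.norm.const_mul _).add (hW.integrable_deriv.norm.const_mul _)
  have hF₀ : ∀ x, ‖F x‖ = F x := fun x => Real.norm_of_nonneg (by positivity)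
  have hFint : ∫ x, ‖F x‖ ≤ θ * (3 * M + 1) := by
    have hderiv : (2 * ‖k‖)⁻¹ * ∫ x, ‖deriv W x‖ ≤ θ := by
      rw [inv_mul_le_iff₀ (by positivity), mul_comm]
      exact hW.integral_norm_deriv_le.trans hθ
    have hmass : 3 * θ * ∫ x, ‖W x‖ ≤ 3 * θ * M := by
      gcongr
      exact hW.integral_norm_le
    simp only [hF₀]
    rw [integral_add (hW.integrable.norm.const_mul _) (hW.integrable_deriv.norm.const_mul _),
      integral_const_mul, integral_const_mul]
    linarith
  refine ((HasDampedBound.of_integrable hk.le hF).of_norm_le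
    (aestronglyMeasurable_correctedSource hW hyc) hS₀ (.of_forall fun x => ?_)).mono (by nlinarith)
  rw [hF₀]
  exact norm_correctedSource_le hk₀ hW hθ (hS x)

lemma norm_corrected_le (hk : 0 < k.im) (hW : IsRegularPotential W M B)
    (hθ : B ≤ θ * (2 * ‖k‖)) (hθ₁ : θ ≤ 1) (hG : HasDampedBound k.im G N) (hS : ∀ x, ‖y x‖ ≤ S)
    (hy : ∀ x, HasDerivAt y (𝓜 (-(Complex.I * k) • alpha + W x) (y x) + G x) x) (x : ℝ) :
    ‖y x 0 - corrector k W x * y x 1‖ ≤ Real.exp M * (2 * N + θ * (3 * M + 1) * S) := by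
  have hk₀ : k ≠ 0 := fun h => by simp [h] at hk
  have hyc : Continuous y := continuous_iff_continuousAt.2 fun x => (hy x).continuousAt
  have hΨ := norm_corrector_le (norm_pos_iff.2 hk₀) hW hθ
  have hθ₀ : 0 ≤ θ := (norm_nonneg _).trans (hΨ 0)
  have hS₀ : 0 ≤ S := (norm_nonneg _).trans (hS 0)
  have hsource : HasDampedBound k.im (fun x => G x 0 - corrector k W x * G x 1) (2 * N) := by
    have hmeas : ∀ i : Fin 2, AEStronglyMeasurable fun x => G x i := fun i =>
      (EuclideanSpace.proj i : Spinor →L[ℂ] ℂ).continuous.comp_aestronglyMeasurable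
        hG.aestronglyMeasurable
    refine hG.of_norm_le ((hmeas 0).sub
      ((continuous_corrector hW).aestronglyMeasurable.mul (hmeas 1))) zero_le_two
      (.of_forall fun x => (norm_sub_le _ _).trans ?_)
    rw [norm_mul, two_mul]
    exact add_le_add (PiLp.norm_apply_le _ _) ((mul_le_of_le_one_left (norm_nonneg _)
      ((hΨ x).trans hθ₁)).trans (PiLp.norm_apply_le _ _))
  have hbounded : ∀ x, ‖y x 0 - corrector k W x * y x 1‖ ≤ S + θ * S := fun x => by
    refine (norm_sub_le _ _).trans (add_le_add ((PiLp.norm_apply_le _ _).trans (hS x)) ?_)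
    rw [norm_mul]
    gcongr
    exacts [hΨ x, (PiLp.norm_apply_le _ _).trans (hS x)]
  have h := norm_le_of_hasDerivAt_damped hk (hW.continuous_entry 0 0) (hW.integrable_entry 0 0)
    ((hasDampedBound_correctedSource hk hW hθ hyc hS).add hsource) hbounded
    (fun x => hasDerivAt_corrected hk₀ hW (hy x)) x
  refine h.trans ?_
  rw [add_comm]
  have hN := hG.nonneg
  have hM := hW.mass_nonneg
  gcongr
  exact hW.integral_norm_entry_le 0 0

lemma norm_upper_le (hk : 0 < k.im) (hW : IsRegularPotential W M B)
    (hθ : B ≤ θ * (2 * ‖k‖)) (hθ₁ : θ ≤ 1) (hG : HasDampedBound k.im G N) (hS : ∀ x, ‖y x‖ ≤ S)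
    (hy : ∀ x, HasDerivAt y (𝓜 (-(Complex.I * k) • alpha + W x) (y x) + G x) x) (x : ℝ) :
    ‖y x 0‖ ≤ Real.exp M * (2 * N + θ * (3 * M + 2) * S) := by
  have hk₀ : 0 < ‖k‖ := norm_pos_iff.2 fun h => by simp [h] at hk
  have hS₀ : 0 ≤ S := (norm_nonneg _).trans (hS 0)
  have hΨ := norm_corrector_le hk₀ hW hθ x
  have hθ₀ : 0 ≤ θ := (norm_nonneg _).trans hΨ
  have hcorr : ‖corrector k W x * y x 1‖ ≤ Real.exp M * (θ * S) := by
    rw [norm_mul]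
    refine le_trans ?_ (le_mul_of_one_le_left (by positivity) (Real.one_le_exp hW.mass_nonneg))
    gcongr
    exact (PiLp.norm_apply_le _ _).trans (hS x)
  calc ‖y x 0‖
      ≤ ‖y x 0 - corrector k W x * y x 1‖ + ‖corrector k W x * y x 1‖ := by
        simpa using norm_add_le (y x 0 - corrector k W x * y x 1) (corrector k W x * y x 1)
    _ ≤ Real.exp M * (2 * N + θ * (3 * M + 1) * S) + Real.exp M * (θ * S) :=
        add_le_add (norm_corrected_le hk hW hθ hθ₁ hG hS hy x) hcorr
    _ = Real.exp M * (2 * N + θ * (3 * M + 2) * S) := by ring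

lemma norm_lower_le (hk : 0 < k.im) (hW : IsRegularPotential W M B)
    (hG : HasDampedBound k.im G N) {b : ℝ} (hb : ∀ x, ‖y x 0‖ ≤ b) (hS : ∀ x, ‖y x‖ ≤ S)
    (hy : ∀ x, HasDerivAt y (𝓜 (-(Complex.I * k) • alpha + W x) (y x) + G x) x) (x : ℝ) :
    ‖y x 1‖ ≤ Real.exp M * (b * M + N) := by
  have hb₀ : 0 ≤ b := (norm_nonneg _).trans (hb 0)
  have hyc : Continuous y := continuous_iff_continuousAt.2 fun x => (hy x).continuousAt
  have hyc₀ : Continuous fun x => y x 0 := by fun_prop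
  have hcoupling : HasDampedBound k.im (fun x => W x 1 0 * y x 0) (b * ∫ x, ‖W x 1 0‖) :=
    (HasDampedBound.of_integrable hk.le (hW.integrable_entry 1 0)).of_norm_le
      ((hW.continuous_entry 1 0).mul hyc₀).aestronglyMeasurable hb₀
      (.of_forall fun x => by rw [norm_mul, mul_comm]; gcongr; exact hb x)
  have hsource : HasDampedBound k.im (fun x => G x 1) N := by
    simpa only [one_mul] using hG.of_norm_le (f := fun x => G x 1)
      ((EuclideanSpace.proj 1 : Spinor →L[ℂ] ℂ).continuous.comp_aestronglyMeasurable
        hG.aestronglyMeasurable) zero_le_one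
      (.of_forall fun x => by rw [one_mul]; exact PiLp.norm_apply_le _ _)
  have h := norm_le_of_hasDerivAt_antidamped hk (hW.continuous_entry 1 1)
    (hW.integrable_entry 1 1) (hcoupling.add hsource)
    (fun x => (PiLp.norm_apply_le _ _).trans (hS x)) (fun x => (hasDerivAt_components (hy x)).2) x
  have hN := hG.nonneg
  refine h.trans ?_
  gcongr
  exacts [hW.integral_norm_entry_le 1 1, hW.integral_norm_entry_le 1 0]

/-- The constant in the sup bound for a system whose potential has mass `M`. -/
def systemConst (M : ℝ) : ℝ := 9 * Real.exp M ^ 2 * (1 + M) ^ 2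

lemma nine_le_systemConst (hM : 0 ≤ M) : 9 ≤ systemConst M := by
  have h₁ : 1 ≤ Real.exp M ^ 2 := one_le_pow₀ (Real.one_le_exp hM)
  have h₂ : 1 ≤ (1 + M) ^ 2 := one_le_pow₀ (by linarith)
  unfold systemConst
  nlinarith

lemma norm_le_of_system (hk : 0 < k.im) (hW : IsRegularPotential W M B)
    (hθ : B ≤ θ * (2 * ‖k‖)) (hθ₁ : θ ≤ 1) (hG : HasDampedBound k.im G N) (hS : ∀ x, ‖y x‖ ≤ S)
    (hy : ∀ x, HasDerivAt y (𝓜 (-(Complex.I * k) • alpha + W x) (y x) + G x) x) (x : ℝ) :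
    ‖y x‖ ≤ systemConst M * (N + θ * S) := by
  have hk₀ : 0 < ‖k‖ := norm_pos_iff.2 fun h => by simp [h] at hk
  have hM := hW.mass_nonneg
  have hN := hG.nonneg
  have hS₀ : 0 ≤ S := (norm_nonneg _).trans (hS 0)
  have hθ₀ : 0 ≤ θ := (norm_nonneg _).trans (norm_corrector_le hk₀ hW hθ 0)
  have hexp : 1 ≤ Real.exp M := Real.one_le_exp hM
  set P := 2 * N + θ * (3 * M + 2) * S
  have hP : 0 ≤ P := by positivity
  have hupper : ∀ x, ‖y x 0‖ ≤ Real.exp M * P := norm_upper_le hk hW hθ hθ₁ hG hS hy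
  have hlower := norm_lower_le hk hW hG hupper hS hy x
  calc ‖y x‖ ≤ ‖y x 0‖ + ‖y x 1‖ := norm_le_norm_add_norm _
    _ ≤ Real.exp M * P + Real.exp M * (Real.exp M * P * M + N) := add_le_add (hupper x) hlower
    _ ≤ Real.exp M ^ 2 * (P + (P * M + N)) := by
        have := mul_nonneg (sub_nonneg.2 hexp) (add_nonneg hP hN)
        nlinarith
    _ = Real.exp M ^ 2 * ((2 * M + 3) * N + (1 + M) * (3 * M + 2) * (θ * S)) := by ring
    _ ≤ Real.exp M ^ 2 * ((9 * (1 + M) ^ 2) * N + (9 * (1 + M) ^ 2) * (θ * S)) := by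
        have h₁ : 2 * M + 3 ≤ 9 * (1 + M) ^ 2 := by nlinarith
        have h₂ : (1 + M) * (3 * M + 2) ≤ 9 * (1 + M) ^ 2 := by nlinarith
        exact mul_le_mul_of_nonneg_left (add_le_add (mul_le_mul_of_nonneg_right h₁ hN)
          (mul_le_mul_of_nonneg_right h₂ (by positivity))) (by positivity)
    _ = systemConst M * (N + θ * S) := by rw [systemConst]; ring

end System

/-! ### The sup bound for the Dirac equation -/

lemma exists_schwartz_integral_norm_sub_le {F : Type*} [NormedAddCommGroup F] [NormedSpace ℝ F]
    {f : ℝ → F} (hf : Integrable f) {τ : ℝ} (hτ : 0 < τ) :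
    ∃ W : 𝓢(ℝ, F), ∫ x, ‖f x - W x‖ ≤ τ := by
  obtain ⟨W, hW⟩ := (SchwartzMap.denseRange_toLpCLM (E := ℝ) (F := F) (p := 1)
    ENNReal.one_ne_top (μ := volume)).exists_dist_lt hf.toL1 hτ
  refine ⟨W, le_of_eq_of_le ?_ hW.le⟩
  rw [dist_eq_norm, L1.norm_eq_integral_norm]
  refine integral_congr_ae ?_
  filter_upwards [Lp.coeFn_sub hf.toL1 (SchwartzMap.toLpCLM ℝ F 1 volume W), hf.coeFn_toL1,
    W.coeFn_toLp 1 volume] with x hsub hf' hW'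
  simp only [SchwartzMap.toLpCLM_apply] at hsub ⊢
  rw [hsub, Pi.sub_apply, hf', hW']

lemma exists_isRegularPotential_sub {V : ℝ → Matrix (Fin 2) (Fin 2) ℂ} (hV : Integrable V)
    {τ : ℝ} (hτ : 0 < τ) :
    ∃ W B, IsRegularPotential W ((∫ x, ‖V x‖) + τ) B ∧ ∫ x, ‖V x - W x‖ ≤ τ := by
  obtain ⟨W, hW⟩ := exists_schwartz_integral_norm_sub_le hV hτ
  have hsub : Integrable fun x => V x - W x := hV.sub W.integrable
  have hderiv : deriv W = SchwartzMap.derivCLM ℝ _ W := by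
    ext1 x
    exact (SchwartzMap.derivCLM_apply ℝ W x).symm
  refine ⟨W, max (SchwartzMap.seminorm ℝ 0 0 W) (∫ x, ‖deriv W x‖),
    { differentiable := W.differentiable
      integrable := W.integrable
      integral_norm_le := ?_
      norm_le := fun x => (W.norm_le_seminorm ℝ x).trans (le_max_left _ _)
      integrable_deriv := by rw [hderiv]; exact (SchwartzMap.derivCLM ℝ _ W).integrable
      integral_norm_deriv_le := le_max_right _ _ }, hW⟩
  calc ∫ x, ‖W x‖ ≤ ∫ x, (‖V x‖ + ‖V x - W x‖) :=
        integral_mono W.integrable.norm (hV.norm.add hsub.norm) fun x => by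
          simpa [norm_sub_rev, add_comm] using norm_add_le (V x) (W x - V x)
    _ = (∫ x, ‖V x‖) + ∫ x, ‖V x - W x‖ := integral_add hV.norm hsub.norm
    _ ≤ (∫ x, ‖V x‖) + τ := by gcongr

lemma IsRegularPotential.mul_mul {W : ℝ → Matrix (Fin 2) (Fin 2) ℂ} {M B : ℝ}
    (hW : IsRegularPotential W M B) {P Q : Matrix (Fin 2) (Fin 2) ℂ} {c : ℝ}
    (hc : ‖P‖ * ‖Q‖ ≤ c) : IsRegularPotential (fun x => P * W x * Q) (c * M) (c * B) := by
  have hc₀ : 0 ≤ c := le_trans (by positivity) hc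
  have hnorm : ∀ A, ‖P * A * Q‖ ≤ c * ‖A‖ := fun A => by
    calc ‖P * A * Q‖ ≤ ‖P‖ * ‖A‖ * ‖Q‖ := (norm_mul_le _ _).trans (by gcongr; exact norm_mul_le _ _)
      _ = ‖P‖ * ‖Q‖ * ‖A‖ := by ring
      _ ≤ c * ‖A‖ := by gcongr
  have hderiv : deriv (fun x => P * W x * Q) = fun x => P * deriv W x * Q := funext fun x =>
    (((hW.differentiable x).hasDerivAt.const_mul P).mul_const Q).deriv
  have hmass : ∀ {A : ℝ → Matrix (Fin 2) (Fin 2) ℂ} {b : ℝ}, Integrable A → ∫ x, ‖A x‖ ≤ b →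
      Integrable (fun x => P * A x * Q) ∧ ∫ x, ‖P * A x * Q‖ ≤ c * b := fun {A b} hA hb => by
    have hint : Integrable fun x => P * A x * Q := (hA.const_mul P).mul_const Q
    refine ⟨hint, (integral_mono hint.norm (hA.norm.const_mul c) fun x => hnorm _).trans ?_⟩
    rw [integral_const_mul]
    gcongr
  exact
    { differentiable := (hW.differentiable.const_mul P).mul_const Q
      integrable := (hmass hW.integrable hW.integral_norm_le).1
      integral_norm_le := (hmass hW.integrable hW.integral_norm_le).2
      norm_le := fun x => (hnorm _).trans (by gcongr; exact hW.norm_le x)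
      integrable_deriv := hderiv ▸ (hmass hW.integrable_deriv hW.integral_norm_deriv_le).1
      integral_norm_deriv_le := hderiv ▸
        (hmass hW.integrable_deriv hW.integral_norm_deriv_le).2 }

lemma alpha_mul_alpha : alpha * alpha = 1 := by
  simp [alpha, Matrix.one_fin_two]

lemma beta_mul_beta : beta * beta = 1 := by
  simp [beta, Matrix.one_fin_two]

lemma beta_mul_alpha : beta * alpha = -(alpha * beta) := by
  simp [alpha, beta]

lemma conjTranspose_alpha : alpha.conjTranspose = alpha := by
  ext i j; fin_cases i <;> fin_cases j <;> simp [alpha]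

lemma conjTranspose_beta : beta.conjTranspose = beta := by
  ext i j; fin_cases i <;> fin_cases j <;> simp [beta]

lemma norm_alpha : ‖alpha‖ = 1 :=
  CStarRing.norm_of_mem_unitary <| Unitary.mem_iff.2 (by
    simp [Matrix.star_eq_conjTranspose, conjTranspose_alpha, alpha_mul_alpha])

lemma norm_beta : ‖beta‖ = 1 :=
  CStarRing.norm_of_mem_unitary <| Unitary.mem_iff.2 (by
    simp [Matrix.star_eq_conjTranspose, conjTranspose_beta, beta_mul_beta])

lemma abs_im_le_abs_im_of_mul_eq {m : ℝ} {z k a : ℂ} (ham : a * m = z - k) (ha : a * (z + k) = m)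
    (ha₁ : ‖a‖ < 1) : |z.im| ≤ |k.im| := by
  -- as `m` is real, `z - k = a conj(m) = |a|² conj(z + k)`
  have hconj : z - k = (‖a‖ ^ 2 : ℝ) * (starRingEnd ℂ) (z + k) := by
    rw [← ham, ← Complex.conj_ofReal m, ← ha, map_mul, ← mul_assoc, Complex.mul_conj',
      Complex.ofReal_pow]
  have him := congrArg Complex.im hconj
  simp only [Complex.sub_im, Complex.im_ofReal_mul, Complex.conj_im, Complex.add_im] at him
  have hsq : 0 ≤ ‖a‖ ^ 2 ∧ 0 < 1 - ‖a‖ ^ 2 := ⟨sq_nonneg _, by nlinarith [norm_nonneg a]⟩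
  have habs : |z.im| * (1 + ‖a‖ ^ 2) = |k.im| * (1 - ‖a‖ ^ 2) := by
    rw [← abs_of_pos hsq.2, ← abs_of_nonneg (show 0 ≤ 1 + ‖a‖ ^ 2 by linarith), ← abs_mul,
      ← abs_mul]
    exact congrArg abs (by linarith)
  nlinarith [abs_nonneg z.im, abs_nonneg k.im]

/-- `k` is the root of `k² = z² - m²` closer to `z`. -/
lemma exists_frequency {m : ℝ} {z : ℂ} (hz : z ≠ 0) (hmz : 2 * |m| ≤ ‖z‖) :
    ∃ k a : ℂ, a * m = z - k ∧ a * (z + k) = m ∧ ‖a‖ ≤ 1 / 2 ∧ ‖z‖ / 2 ≤ ‖k‖ ∧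
      |z.im| ≤ |k.im| := by
  have hz₀ : 0 < ‖z‖ := norm_pos_iff.2 hz
  obtain ⟨k, hk, hle⟩ : ∃ k : ℂ, k ^ 2 = z ^ 2 - m ^ 2 ∧ ‖z - k‖ ≤ ‖z + k‖ := by
    obtain ⟨s, hs⟩ := IsAlgClosed.exists_pow_nat_eq (z ^ 2 - (m : ℂ) ^ 2) two_pos
    rcases le_total ‖z - s‖ ‖z + s‖ with h | h
    · exact ⟨s, hs, h⟩
    · exact ⟨-s, by rw [neg_sq, hs], by simpa [sub_eq_add_neg] using h⟩
  have hzk : ‖z‖ ≤ ‖z + k‖ := by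
    have := norm_add_le (z - k) (z + k)
    rw [sub_add_add_cancel, ← two_mul, norm_mul, Complex.norm_ofNat] at this
    linarith
  have hzk₀ : z + k ≠ 0 := norm_pos_iff.1 (hz₀.trans_le hzk)
  have ha : m / (z + k) * (z + k) = m := div_mul_cancel₀ _ hzk₀
  have ham : m / (z + k) * m = z - k := by
    field_simp
    linear_combination hk
  have hnorm : ‖(m : ℂ) / (z + k)‖ ≤ 1 / 2 := by
    rw [norm_div, Complex.norm_real, Real.norm_eq_abs, div_le_iff₀ (hz₀.trans_le hzk)]
    linarith
  have hzk' : ‖z - k‖ ≤ 1 / 2 * |m| := by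
    rw [← ham, norm_mul, Complex.norm_real, Real.norm_eq_abs]
    gcongr
  refine ⟨k, m / (z + k), ham, ha, hnorm, ?_,
    abs_im_le_abs_im_of_mul_eq ham ha (hnorm.trans_lt (by norm_num))⟩
  have h := norm_sub_norm_le z (z - k)
  rw [sub_sub_cancel] at h
  linarith

lemma one_sub_smul_beta_mul_symbol {m : ℝ} {z k a : ℂ} (hz : a * m = z - k)
    (hm : a * (z + k) = m) :
    (1 - a • beta) * (-Complex.I • alpha * (z • 1 - (m : ℂ) • beta))
      = -(Complex.I * k) • alpha * (1 - a • beta) := by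
  simp only [alpha, beta, Matrix.one_fin_two]
  ext i j
  fin_cases i <;> fin_cases j <;> simp [Matrix.mul_apply, Fin.sum_univ_two] <;> grind

lemma inv_smul_one_add_smul_beta_mul {a : ℂ} (ha : 1 - a ^ 2 ≠ 0) :
    (1 - a ^ 2)⁻¹ • (1 + a • beta) * (1 - a • beta) = 1 := by
  have h : (1 + a • beta) * (1 - a • beta) = (1 - a ^ 2) • (1 : Matrix (Fin 2) (Fin 2) ℂ) := by
    simp only [add_mul, mul_sub, one_mul, mul_one, smul_mul_smul_comm, beta_mul_beta]
    module
  rw [smul_mul_assoc, h, smul_smul, inv_mul_cancel₀ ha, one_smul]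

/-- In the variable `P u` the free equation `D_m u = z u` is diagonal. The case `Im k < 0` is
reduced to `Im k > 0` by exchanging the two components. -/
lemma exists_diagonalization {m : ℝ} {z : ℂ} (hz : z.im ≠ 0) (hmz : 2 * |m| ≤ ‖z‖) :
    ∃ (k : ℂ) (P Q : Matrix (Fin 2) (Fin 2) ℂ), |z.im| ≤ k.im ∧ ‖z‖ / 2 ≤ ‖k‖ ∧
      ‖P‖ ≤ 3 / 2 ∧ ‖Q‖ ≤ 2 ∧ Q * P = 1 ∧
      P * (-Complex.I • alpha * (z • 1 - (m : ℂ) • beta)) = -(Complex.I * k) • alpha * P := by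
  obtain ⟨k, a, ham, hazk, ha, hkz, him⟩ := exists_frequency (fun h => hz (by simp [h])) hmz
  have haβ : ‖a • beta‖ ≤ 1 / 2 := by rwa [norm_smul, norm_beta, mul_one]
  have hden : 3 / 4 ≤ ‖1 - a ^ 2‖ := by
    have := norm_sub_norm_le 1 (a ^ 2)
    rw [norm_one, norm_pow] at this
    nlinarith [norm_nonneg a]
  have hP : ‖1 - a • beta‖ ≤ 3 / 2 := (norm_sub_le _ _).trans (by rw [norm_one]; linarith)
  have hQ : ‖(1 - a ^ 2)⁻¹ • (1 + a • beta)‖ ≤ 2 := by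
    have : ‖1 + a • beta‖ ≤ 3 / 2 := (norm_add_le _ _).trans (by rw [norm_one]; linarith)
    rw [norm_smul, norm_inv, inv_mul_le_iff₀ (by linarith)]
    linarith
  have hQP := inv_smul_one_add_smul_beta_mul (norm_pos_iff.1 (hden.trans_lt' (by norm_num)))
  have hdiag := one_sub_smul_beta_mul_symbol ham hazk
  generalize 1 - a • beta = P at *
  generalize (1 - a ^ 2)⁻¹ • (1 + a • beta) = Q at *
  rcases le_or_gt 0 k.im with hk | hk
  · exact ⟨k, P, Q, him.trans_eq (abs_of_nonneg hk), hkz, hP, hQ, hQP, hdiag⟩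
  · refine ⟨-k, beta * P, Q * beta, him.trans_eq (abs_of_neg hk), by rwa [norm_neg], ?_, ?_, ?_,
      ?_⟩
    · exact (norm_mul_le _ _).trans (by rwa [norm_beta, one_mul])
    · exact (norm_mul_le _ _).trans (by rwa [norm_beta, mul_one])
    · rw [mul_assoc, ← mul_assoc beta, beta_mul_beta, one_mul, hQP]
    · rw [mul_assoc, hdiag, ← mul_assoc, mul_smul_comm, beta_mul_alpha]
      simp [mul_assoc]

lemma toEuclideanCLM_mul_apply (A B : Matrix (Fin 2) (Fin 2) ℂ) (v : Spinor) :
    𝓜 (A * B) v = 𝓜 A (𝓜 B v) := by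
  rw [map_mul]
  rfl

/-- The differential expression `(D_m + V - z) u = iα u' + (mβ + V - z) u`, for a classically
differentiable `u`. -/
def diracExpr (m : ℝ) (V : ℝ → Matrix (Fin 2) (Fin 2) ℂ) (z : ℂ) (u : ℝ → Spinor) (x : ℝ) :
    Spinor :=
  𝓜 (Complex.I • alpha) (deriv u x) + 𝓜 ((m : ℂ) • beta + V x - z • 1) (u x)

section Dirac

variable {m N τ θ S M B : ℝ} {V W : ℝ → Matrix (Fin 2) (Fin 2) ℂ} {z k : ℂ}
  {P Q : Matrix (Fin 2) (Fin 2) ℂ} {u : ℝ → Spinor}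

lemma hasDerivAt_diagonalized (hu : Differentiable ℝ u) (hQP : Q * P = 1)
    (hP : P * (-Complex.I • alpha * (z • 1 - (m : ℂ) • beta)) = -(Complex.I * k) • alpha * P)
    (x : ℝ) :
    HasDerivAt (fun x => 𝓜 P (u x))
      (𝓜 (-(Complex.I * k) • alpha + P * (Complex.I • alpha) * W x * Q) (𝓜 P (u x))
        + 𝓜 (P * (Complex.I • alpha)) (-diracExpr m V z u x + 𝓜 (V x - W x) (u x))) x := by
  have hd : HasDerivAt (fun x => 𝓜 P (u x)) (𝓜 P (deriv u x)) x :=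
    ((𝓜 P).restrictScalars ℝ).hasFDerivAt.comp_hasDerivAt x (hu x).hasDerivAt
  refine hd.congr_deriv ?_
  set A := P * (Complex.I • alpha) with hA
  have hAA : A * (Complex.I • alpha) = -P := by
    rw [hA, mul_assoc, smul_mul_smul_comm, alpha_mul_alpha, Complex.I_mul_I]
    simp
  have hfree : -(Complex.I * k) • alpha * P = -(A * (z • 1 - (m : ℂ) • beta)) := by
    rw [← hP, hA, ← mul_assoc, neg_smul, mul_neg, neg_mul]
  have hpot : (-(Complex.I * k) • alpha + A * W x * Q) * P
      = A * ((m : ℂ) • beta + V x - z • 1) - A * (V x - W x) := by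
    rw [add_mul, hfree, mul_assoc _ Q, hQP]
    simp only [mul_sub, mul_add, mul_one]
    abel
  rw [diracExpr]
  generalize (m : ℂ) • beta + V x - z • 1 = B, V x - W x = D at *
  simp only [map_add (𝓜 A), map_neg (𝓜 A), ← toEuclideanCLM_mul_apply, hpot, hAA, map_sub, map_neg,
    sub_apply, neg_apply]
  abel

lemma norm_toEuclideanCLM_le (A : Matrix (Fin 2) (Fin 2) ℂ) (v : Spinor) :
    ‖𝓜 A v‖ ≤ ‖A‖ * ‖v‖ :=
  (𝓜 A).le_opNorm v

lemma aestronglyMeasurable_toEuclideanCLM {A : ℝ → Matrix (Fin 2) (Fin 2) ℂ} {v : ℝ → Spinor}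
    (hA : AEStronglyMeasurable A) (hv : AEStronglyMeasurable v) :
    AEStronglyMeasurable fun x => 𝓜 (A x) (v x) := by
  have hcont : Continuous fun A : Matrix (Fin 2) (Fin 2) ℂ => 𝓜 A :=
    (AddMonoidHomClass.isometry_of_norm 𝓜 fun _ => rfl).continuous
  exact isBoundedBilinearMap_apply.continuous.comp_aestronglyMeasurable₂
    (hcont.comp_aestronglyMeasurable hA) hv

lemma hasDampedBound_diagonalizedSource {κ : ℝ} (hκ : 0 ≤ κ) (hP : ‖P‖ ≤ 3 / 2)
    (hu : Continuous u) (hS : ∀ x, ‖u x‖ ≤ S) (hVW : Integrable fun x => V x - W x)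
    (hτ : ∫ x, ‖V x - W x‖ ≤ τ) {f : ℝ → Spinor} (hf : HasDampedBound κ f N) :
    HasDampedBound κ (fun x => 𝓜 (P * (Complex.I • alpha)) (-f x + 𝓜 (V x - W x) (u x)))
      (3 / 2 * (N + S * τ)) := by
  have hS₀ : 0 ≤ S := (norm_nonneg _).trans (hS 0)
  have hpert : HasDampedBound κ (fun x => 𝓜 (V x - W x) (u x)) (S * τ) :=
    ((HasDampedBound.of_integrable hκ hVW).mono hτ).of_norm_le
      (aestronglyMeasurable_toEuclideanCLM hVW.1 hu.aestronglyMeasurable) hS₀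
      (.of_forall fun x => (norm_toEuclideanCLM_le _ _).trans (by
        rw [mul_comm]
        gcongr
        exact hS x))
  have hsum := hf.neg.add hpert
  refine hsum.of_norm_le ((𝓜 _).continuous.comp_aestronglyMeasurable hsum.aestronglyMeasurable)
    (by norm_num) (.of_forall fun x => (norm_toEuclideanCLM_le _ _).trans ?_)
  gcongr
  refine (norm_mul_le _ _).trans ?_
  rwa [norm_smul, norm_alpha, Complex.norm_I, mul_one, mul_one]

lemma norm_le_of_regular_approx (hz : z.im ≠ 0) (hmz : 2 * |m| ≤ ‖z‖)
    (hW : IsRegularPotential W M B) (hθ : 3 * B ≤ θ * ‖z‖) (hθ₁ : θ ≤ 1)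
    (hVW : Integrable fun x => V x - W x) (hτ : ∫ x, ‖V x - W x‖ ≤ τ)
    (hu : Differentiable ℝ u) (hS : ∀ x, ‖u x‖ ≤ S)
    (hf : HasDampedBound |z.im| (diracExpr m V z u) N) (x : ℝ) :
    ‖u x‖ ≤ 3 * systemConst (3 * M) * (N + (τ + θ) * S) := by
  obtain ⟨k, P, Q, him, hkz, hP, hQ, hQP, hdiag⟩ := exists_diagonalization hz hmz
  have hk : 0 < k.im := (abs_pos.2 hz).trans_le him
  have hθ₀ : 0 ≤ θ := by
    have hB : 0 ≤ B := (norm_nonneg _).trans (hW.norm_le 0)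
    have hz₀ : 0 < ‖z‖ := norm_pos_iff.2 fun h => hz (by simp [h])
    by_contra! h
    nlinarith
  have hW' := hW.mul_mul (P := P * (Complex.I • alpha)) (Q := Q) (c := 3) (by
    have : ‖P * (Complex.I • alpha)‖ ≤ 3 / 2 := (norm_mul_le _ _).trans (by
      rwa [norm_smul, norm_alpha, Complex.norm_I, mul_one, mul_one])
    nlinarith [norm_nonneg Q])
  have hy : ‖𝓜 P (u x)‖ ≤ systemConst (3 * M) * (3 / 2 * (N + S * τ) + θ * (3 / 2 * S)) :=
    norm_le_of_system hk hW' (by nlinarith) hθ₁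
      ((hasDampedBound_diagonalizedSource (abs_nonneg _) hP hu.continuous hS hVW hτ hf).anti him)
      (fun x => (norm_toEuclideanCLM_le _ _).trans (mul_le_mul hP (hS x) (norm_nonneg _)
        (by norm_num)))
      (hasDerivAt_diagonalized hu hQP hdiag) x
  calc ‖u x‖ = ‖𝓜 Q (𝓜 P (u x))‖ := by rw [← toEuclideanCLM_mul_apply, hQP]; simp
    _ ≤ ‖Q‖ * ‖𝓜 P (u x)‖ := norm_toEuclideanCLM_le _ _
    _ ≤ 2 * (systemConst (3 * M) * (3 / 2 * (N + S * τ) + θ * (3 / 2 * S))) := by gcongr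
    _ = 3 * systemConst (3 * M) * (N + (τ + θ) * S) := by ring

lemma exists_norm_le_of_diracExpr (m : ℝ) (hV : Integrable V) :
    ∃ R C : ℝ, 0 ≤ C ∧ ∀ z : ℂ, z.im ≠ 0 → R ≤ ‖z‖ → ∀ (u : ℝ → Spinor) (S N : ℝ),
      Differentiable ℝ u → (∀ x, ‖u x‖ ≤ S) → HasDampedBound |z.im| (diracExpr m V z u) N →
      ∀ x, ‖u x‖ ≤ C * N := by
  set M := (∫ x, ‖V x‖) + 1
  set K := systemConst (3 * M)
  have hK : 9 ≤ K := nine_le_systemConst (by positivity)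
  -- the smallness `3 K (τ + θ) = 1 / 2` lets `sup ‖u‖` be absorbed
  set τ := 1 / (12 * K)
  have hτ : 0 < τ := by positivity
  have hτ₁ : τ ≤ 1 := (div_le_one (by positivity)).2 (by linarith)
  obtain ⟨W, B, hW, hVW⟩ := exists_isRegularPotential_sub hV hτ
  replace hW : IsRegularPotential W M B :=
    { hW with integral_norm_le := hW.integral_norm_le.trans (add_le_add_right hτ₁ _) }
  refine ⟨max (2 * |m|) (3 * B / τ), 6 * K, by positivity, fun z hz hzR u S N hu hS hf => ?_⟩
  have hbound : ∀ x, ‖u x‖ ≤ 3 * K * N + (⨆ x, ‖u x‖) / 2 := fun x => by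
    have h := norm_le_of_regular_approx hz ((le_max_left _ _).trans hzR) hW
      ((div_le_iff₀' hτ).1 ((le_max_right _ _).trans hzR)) hτ₁ (hV.sub hW.integrable) hVW hu
      (fun x => le_ciSup ⟨S, Set.forall_mem_range.2 hS⟩ x) hf x
    refine h.trans_eq ?_
    simp only [τ]
    field_simp
    ring
  have hsup : ⨆ x, ‖u x‖ ≤ 6 * K * N := by linarith [ciSup_le hbound]
  exact fun x => (le_ciSup ⟨S, Set.forall_mem_range.2 hS⟩ x).trans hsup

end Dirac

/-! ### Schwartz functions form a core for the derivative -/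

/-- The inclusion of Schwartz spinors into `L²(ℝ; ℂ²)`. -/
def toL2 : 𝓢(ℝ, Spinor) →L[ℂ] SpinorL2 := SchwartzMap.toLpCLM ℂ Spinor 2 volume

lemma coeFn_toL2 (φ : 𝓢(ℝ, Spinor)) : toL2 φ =ᵐ[volume] φ := φ.coeFn_toLp 2 volume

lemma denseRange_toL2 : DenseRange toL2 :=
  SchwartzMap.denseRange_toLpCLM (by simp)

lemma hasDistribDeriv_toL2 (φ : 𝓢(ℝ, Spinor)) :
    HasDistribDeriv (toL2 φ) (toL2 (∂_{(1 : ℝ)} φ)) := by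
  simp only [HasDistribDeriv, toL2, SchwartzMap.toLpCLM_apply, Lp.toTemperedDistribution_toLp_eq]
  exact TemperedDistribution.lineDerivOp_toTemperedDistributionCLM_eq φ 1

lemma HasDistribDeriv.of_tendsto {u g : SpinorL2} {un gn : ℕ → SpinorL2}
    (h : ∀ n, HasDistribDeriv (un n) (gn n)) (hu : Tendsto un atTop (𝓝 u))
    (hg : Tendsto gn atTop (𝓝 g)) : HasDistribDeriv u g := by
  have tendsto_apply : ∀ {v : ℕ → SpinorL2} {w}, Tendsto v atTop (𝓝 w) → ∀ η : 𝓢(ℝ, ℂ),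
      Tendsto (fun n => (v n : 𝓢'(ℝ, Spinor)) η) atTop (𝓝 ((w : 𝓢'(ℝ, Spinor)) η)) :=
    fun hv η => ((PointwiseConvergenceCLM.evalCLM (RingHom.id ℂ) Spinor η).comp
      (Lp.toTemperedDistributionCLM Spinor volume 2)).continuous.continuousAt.tendsto.comp hv
  unfold HasDistribDeriv
  ext1 η
  refine tendsto_nhds_unique (tendsto_apply hu (-∂_{(1 : ℝ)} η))
    ((tendsto_apply hg η).congr fun n => ?_)
  exact (congrArg (fun T : 𝓢'(ℝ, Spinor) => T η) (h n)).symm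

lemma inner_toL2 (φ : 𝓢(ℝ, Spinor)) (u : SpinorL2) :
    inner ℂ (toL2 φ) u = ∫ x, inner ℂ (φ x) (u x) := by
  rw [L2.inner_def]
  refine integral_congr_ae ?_
  filter_upwards [coeFn_toL2 φ] with x hx
  rw [hx]

lemma inner_toL2_lineDerivOp (φ χ : 𝓢(ℝ, Spinor)) :
    inner ℂ (toL2 φ) (toL2 (∂_{(1 : ℝ)} χ)) = -inner ℂ (toL2 (∂_{(1 : ℝ)} φ)) (toL2 χ) := by
  have inner_eq (φ χ : 𝓢(ℝ, Spinor)) :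
      inner ℂ (toL2 φ) (toL2 χ) = ∫ x, inner ℂ (φ x) (χ x) := by
    rw [inner_toL2]
    refine integral_congr_ae ?_
    filter_upwards [coeFn_toL2 χ] with x hx
    rw [hx]
  rw [inner_eq, inner_eq]
  exact SchwartzMap.integral_bilinear_lineDerivOp_right_eq_neg_left φ χ
    (isBoundedBilinearMap_inner (𝕜 := ℂ) (E := Spinor)).toContinuousLinearMap 1

lemma lineDerivOp_postcompCLM {F G : Type*} [NormedAddCommGroup F] [NormedSpace ℝ F]
    [NormedAddCommGroup G] [NormedSpace ℝ G] (L : F →L[ℝ] G) (η : 𝓢(ℝ, F)) (v : ℝ) :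
    ∂_{v} (η.postcompCLM L) = (∂_{v} η).postcompCLM L := by
  ext x
  simp only [SchwartzMap.postcompCLM_apply, SchwartzMap.lineDerivOp_apply_eq_fderiv]
  exact congrArg (fun T : ℝ →L[ℝ] G => T v) (L.hasFDerivAt.comp x (η.hasFDerivAt x)).fderiv

lemma integrable_schwartz_smul (η : 𝓢(ℝ, ℂ)) (w : SpinorL2) : Integrable fun x => η x • w x :=
  memLp_one_iff_integrable.1 ((Lp.memLp w).smul (η.memLp 2 volume))

lemma hasDistribDeriv_of_inner {u g : SpinorL2}
    (h : ∀ χ : 𝓢(ℝ, Spinor), inner ℂ (toL2 (∂_{(1 : ℝ)} χ)) u = -inner ℂ (toL2 χ) g) :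
    HasDistribDeriv u g := by
  unfold HasDistribDeriv
  ext1 η
  rw [TemperedDistribution.lineDerivOp_apply_apply, Lp.toTemperedDistribution_apply,
    Lp.toTemperedDistribution_apply]
  refine ext_inner_left ℂ fun v => ?_
  rw [← integral_inner (integrable_schwartz_smul _ _),
    ← integral_inner (integrable_schwartz_smul _ _)]
  -- testing the component along `v` against `η` is testing against the spinor `conj η • v`
  let L : ℂ →L[ℝ] Spinor :=
    ((ContinuousLinearMap.toSpanSingleton ℂ v).restrictScalars ℝ).comp
      (Complex.conjCLE : ℂ →L[ℝ] ℂ)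
  have inner_eq (θ : 𝓢(ℝ, ℂ)) (w : SpinorL2) :
      ∫ x, inner ℂ v (θ x • w x) = inner ℂ (toL2 (θ.postcompCLM L)) w := by
    rw [inner_toL2]
    refine integral_congr_ae (Eventually.of_forall fun x => ?_)
    simp [L, SchwartzMap.postcompCLM_apply, mul_comm]
  rw [inner_eq, inner_eq, map_neg, ← lineDerivOp_postcompCLM, map_neg, inner_neg_left, h, neg_neg]

section FourierMultiplier

variable {F : Type*} [NormedAddCommGroup F] [NormedSpace ℂ F]

lemma fourierMultiplierCLM_add {g h : ℝ → ℂ} (hg : g.HasTemperateGrowth)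
    (hh : h.HasTemperateGrowth) (φ : 𝓢(ℝ, F)) :
    SchwartzMap.fourierMultiplierCLM F (g + h) φ =
      SchwartzMap.fourierMultiplierCLM F g φ + SchwartzMap.fourierMultiplierCLM F h φ := by
  simp only [SchwartzMap.fourierMultiplierCLM_apply, SchwartzMap.smulLeftCLM_add hg hh,
    _root_.add_apply, FourierTransform.fourierInv_add]

lemma lineDerivOp_add_smul_eq_fourierMultiplierCLM [CompleteSpace F] (c : ℂ) (φ : 𝓢(ℝ, F)) :
    ∂_{(1 : ℝ)} φ + (2 * Real.pi * c) • φ =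
      (2 * Real.pi : ℂ) • SchwartzMap.fourierMultiplierCLM F
        ((Complex.I • fun ξ : ℝ => (ξ : ℂ)) + fun _ => c) φ := by
  have hξ : (fun ξ : ℝ => (ξ : ℂ)).HasTemperateGrowth := by fun_prop
  rw [fourierMultiplierCLM_add (by fun_prop) (by fun_prop),
    SchwartzMap.fourierMultiplierCLM_smul hξ, SchwartzMap.fourierMultiplierCLM_const,
    SchwartzMap.lineDeriv_eq_fourierMultiplierCLM,
    ← SchwartzMap.fourierMultiplierCLM_ofReal ℂ (by fun_prop), smul_add]
  simp [smul_smul]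

lemma exists_lineDerivOp_add_smul_eq [CompleteSpace F] {c : ℂ} (hc : c ^ 2 = 1) (ψ : 𝓢(ℝ, F)) :
    ∃ φ : 𝓢(ℝ, F), ∂_{(1 : ℝ)} φ + (2 * Real.pi * c) • φ = ψ := by
  have h2π : (2 * Real.pi : ℂ) ≠ 0 := by simp [Real.pi_ne_zero]
  -- `1 / (c + I ξ)`, written so that its temperate growth is visible
  let s : ℝ → ℂ := fun ξ => (c - Complex.I * ξ) * ((1 + ‖ξ‖ ^ 2) ^ (-1 : ℝ) : ℝ)
  have hs : s.HasTemperateGrowth := by fun_prop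
  have mul_s : ((Complex.I • fun ξ : ℝ => (ξ : ℂ)) + fun _ => c) * s = fun _ => 1 := by
    ext ξ
    have hξ : (1 : ℂ) + (ξ : ℂ) ^ 2 ≠ 0 := by
      exact_mod_cast (by positivity : (0 : ℝ) < 1 + ξ ^ 2).ne'
    simp only [s, Pi.add_apply, Pi.smul_apply, Pi.mul_apply, smul_eq_mul, Real.rpow_neg_one,
      Real.norm_eq_abs, sq_abs]
    push_cast
    field_simp
    linear_combination hc - (ξ : ℂ) ^ 2 * Complex.I_sq
  refine ⟨(2 * Real.pi : ℂ)⁻¹ • SchwartzMap.fourierMultiplierCLM F s ψ, ?_⟩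
  rw [lineDerivOp_add_smul_eq_fourierMultiplierCLM, map_smul, smul_inv_smul₀ h2π,
    SchwartzMap.fourierMultiplierCLM_fourierMultiplierCLM_apply (by fun_prop) hs, mul_s,
    SchwartzMap.fourierMultiplierCLM_const]
  simp

end FourierMultiplier

lemma exists_seq_tendsto_of_denseRange {S E Φ : Type*} [AddGroup S] [NormedAddCommGroup E]
    [CompleteSpace E] [FunLike Φ S E] [AddMonoidHomClass Φ S E] (T j : Φ) {C : ℝ}
    (hC : ∀ φ, ‖j φ‖ ≤ C * ‖T φ‖) (hT : DenseRange T) (f : E) :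
    ∃ (φ : ℕ → S) (u : E), Tendsto (fun n => T (φ n)) atTop (𝓝 f) ∧
      Tendsto (fun n => j (φ n)) atTop (𝓝 u) := by
  obtain ⟨x, hx, hxf⟩ := mem_closure_iff_seq_limit.1 (hT f)
  choose φ hφ using hx
  obtain rfl : (fun n => T (φ n)) = x := funext hφ
  have j_cauchy : CauchySeq fun n => j (φ n) := by
    refine cauchySeq_iff_tendsto_dist_atTop_0.2 (squeeze_zero (fun _ => dist_nonneg) (fun p => ?_)
      (by simpa using (cauchySeq_iff_tendsto_dist_atTop_0.1 hxf.cauchySeq).const_mul C))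
    simpa only [dist_eq_norm, map_sub] using hC (φ p.1 - φ p.2)
  obtain ⟨u, hu⟩ := cauchySeq_tendsto_of_complete j_cauchy
  exact ⟨φ, u, hxf, hu⟩

lemma re_inner_toL2_lineDerivOp_self (φ : 𝓢(ℝ, Spinor)) :
    (inner ℂ (toL2 φ) (toL2 (∂_{(1 : ℝ)} φ))).re = 0 := by
  have h := congrArg Complex.re (inner_toL2_lineDerivOp φ φ)
  rw [← inner_conj_symm (toL2 (∂_{(1 : ℝ)} φ)), Complex.neg_re, Complex.conj_re] at h
  linarith

lemma norm_toL2_le_of_lineDerivOp_add (φ : 𝓢(ℝ, Spinor)) {c : ℝ} (hc : 0 < c) :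
    ‖toL2 φ‖ ≤ c⁻¹ * ‖toL2 (∂_{(1 : ℝ)} φ + (c : ℂ) • φ)‖ := by
  have re_inner : (inner ℂ (toL2 φ) (toL2 (∂_{(1 : ℝ)} φ + (c : ℂ) • φ))).re
      = c * ‖toL2 φ‖ ^ 2 := by
    rw [map_add, map_smul, inner_add_right, Complex.add_re, re_inner_toL2_lineDerivOp_self,
      inner_smul_right, inner_self_eq_norm_sq_to_K, zero_add]
    simp [← Complex.ofReal_pow]
  have le_mul := (Complex.re_le_norm _).trans
    (norm_inner_le_norm (𝕜 := ℂ) (toL2 φ) (toL2 (∂_{(1 : ℝ)} φ + (c : ℂ) • φ)))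
  rw [re_inner] at le_mul
  rw [inv_mul_eq_div, le_div_iff₀ hc]
  rcases (norm_nonneg (toL2 φ)).eq_or_lt with h0 | h0
  · rw [← h0, zero_mul]
    exact norm_nonneg _
  · nlinarith

lemma eq_zero_of_hasDistribDeriv_smul {v : SpinorL2} {c : ℂ} (hc : c ^ 2 = 1)
    (h : HasDistribDeriv v ((2 * Real.pi * c) • v)) : v = 0 := by
  refine LinearMap.ker_eq_bot'.1 (Lp.ker_toTemperedDistributionCLM_eq_bot
    (F := Spinor) (μ := (volume : Measure ℝ)) (p := 2)) v ?_
  ext1 η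
  obtain ⟨θ, rfl⟩ := exists_lineDerivOp_add_smul_eq hc η
  have h_apply := congrArg (fun T : 𝓢'(ℝ, Spinor) => T θ) h
  simp only [TemperedDistribution.lineDerivOp_apply_apply, ← Lp.toTemperedDistributionCLM_apply,
    map_smul, map_neg, _root_.smul_apply] at h_apply
  simp only [ContinuousLinearMap.coe_coe, map_add, map_smul, ← h_apply, smul_zero, add_zero,
    add_neg_cancel, _root_.zero_apply]

lemma HasDistribDeriv.exists_schwartz_tendsto {u g : SpinorL2} (h : HasDistribDeriv u g) :
    ∃ φ : ℕ → 𝓢(ℝ, Spinor), Tendsto (fun n => toL2 (φ n)) atTop (𝓝 u) ∧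
      Tendsto (fun n => toL2 (∂_{(1 : ℝ)} (φ n))) atTop (𝓝 g) := by
  set c : ℂ := ((2 * Real.pi : ℝ) : ℂ) with hc
  have hc' : c = 2 * Real.pi * 1 := by simp [hc]
  let T : 𝓢(ℝ, Spinor) →L[ℂ] SpinorL2 :=
    toL2 ∘L (LineDeriv.lineDerivOpCLM ℂ 𝓢(ℝ, Spinor) (1 : ℝ) + c • ContinuousLinearMap.id ℂ _)
  have T_dense : DenseRange T := by
    refine denseRange_toL2.mono ?_
    rintro _ ⟨ψ, rfl⟩
    obtain ⟨φ, rfl⟩ := exists_lineDerivOp_add_smul_eq (c := 1) (by simp) ψ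
    exact ⟨φ, by rw [← hc']; rfl⟩
  obtain ⟨φ, w, hT, hw⟩ := exists_seq_tendsto_of_denseRange T toL2
    (fun φ => norm_toL2_le_of_lineDerivOp_add φ Real.two_pi_pos) T_dense (g + c • u)
  have hd : Tendsto (fun n => toL2 (∂_{(1 : ℝ)} (φ n))) atTop (𝓝 (g + c • u - c • w)) :=
    (hT.sub (hw.const_smul c)).congr fun n => by simp [T]
  have w_deriv : HasDistribDeriv w (g + c • u - c • w) :=
    .of_tendsto (fun n => hasDistribDeriv_toL2 (φ n)) hw hd
  obtain rfl : w = u := by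
    refine sub_eq_zero.1 (eq_zero_of_hasDistribDeriv_smul (c := -1) (by simp) ?_)
    convert w_deriv.add (h.smul (-1)) using 1
    · module
    · rw [hc']
      module
  exact ⟨φ, hw, by simpa using hd⟩

/-! ### Matrix multiplication operators on `L²` -/

lemma inner_toEuclideanCLM_left (A : Matrix (Fin 2) (Fin 2) ℂ) (v w : Spinor) :
    inner ℂ (𝓜 A v) w = inner ℂ v (𝓜 A.conjTranspose w) := by
  rw [← Matrix.star_eq_conjTranspose, map_star, ContinuousLinearMap.star_eq_adjoint,
    ContinuousLinearMap.adjoint_inner_right]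

lemma coeFn_constMatrix (A : Matrix (Fin 2) (Fin 2) ℂ) (u : SpinorL2) :
    constMatrix A u =ᵐ[volume] fun x => 𝓜 A (u x) :=
  ContinuousLinearMap.coeFn_compLpL _ u

lemma inner_constMatrix_left (A : Matrix (Fin 2) (Fin 2) ℂ) (u v : SpinorL2) :
    inner ℂ (constMatrix A u) v = inner ℂ u (constMatrix A.conjTranspose v) := by
  rw [L2.inner_def, L2.inner_def]
  refine integral_congr_ae ?_
  filter_upwards [coeFn_constMatrix A u, coeFn_constMatrix A.conjTranspose v] with x hu hv
  rw [hu, hv, inner_toEuclideanCLM_left]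

lemma constMatrix_alpha_constMatrix_alpha (u : SpinorL2) :
    constMatrix alpha (constMatrix alpha u) = u := by
  refine Lp.ext ?_
  filter_upwards [coeFn_constMatrix alpha (constMatrix alpha u), coeFn_constMatrix alpha u]
    with x hαα hα
  rw [hαα, hα, ← toEuclideanCLM_mul_apply, alpha_mul_alpha, map_one]
  rfl

lemma HasDistribDeriv.constMatrix {u g : SpinorL2} (A : Matrix (Fin 2) (Fin 2) ℂ)
    (h : HasDistribDeriv u g) :
    HasDistribDeriv (Dirac1D.constMatrix A u) (Dirac1D.constMatrix A g) := by
  have constMatrix_apply (w : SpinorL2) (η : 𝓢(ℝ, ℂ)) :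
      ((Dirac1D.constMatrix A w : SpinorL2) : 𝓢'(ℝ, Spinor)) η =
        𝓜 A ((w : 𝓢'(ℝ, Spinor)) η) := by
    rw [Lp.toTemperedDistribution_apply, Lp.toTemperedDistribution_apply,
      ← ContinuousLinearMap.integral_comp_comm _ (integrable_schwartz_smul η w)]
    refine integral_congr_ae ?_
    filter_upwards [coeFn_constMatrix A w] with x hx
    rw [hx, map_smul]
  unfold HasDistribDeriv
  ext1 η
  rw [TemperedDistribution.lineDerivOp_apply_apply, constMatrix_apply, constMatrix_apply]
  exact congrArg _ (congrArg (fun T : 𝓢'(ℝ, Spinor) => T η) h)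

/-- The action of `2 × 2` matrices on spinors as a bounded bilinear map. -/
def matrixAction : Matrix (Fin 2) (Fin 2) ℂ →L[ℂ] Spinor →L[ℂ] Spinor :=
  LinearMap.mkContinuous
    { toFun := fun A => 𝓜 A
      map_add' := map_add 𝓜
      map_smul' := map_smul 𝓜 } 1 fun A => (one_mul ‖A‖).ge

/-- The class of matrix potentials for which the estimates below hold: integrable and essentially
bounded, for the operator norm on `ℂ²`. -/
structure IsPotential (V : ℝ → Matrix (Fin 2) (Fin 2) ℂ) : Prop where
  integrable : Integrable V
  memLp_top : MemLp V ∞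

namespace IsPotential

variable {V : ℝ → Matrix (Fin 2) (Fin 2) ℂ}

lemma conjTranspose (h : IsPotential V) : IsPotential fun x => (V x).conjTranspose where
  integrable := memLp_one_iff_integrable.1 (memLp_one_iff_integrable.2 h.integrable).star
  memLp_top := h.memLp_top.star

/-- Multiplication by the potential as a bounded operator on `L²`. -/
def mulCLM (h : IsPotential V) : SpinorL2 →L[ℂ] SpinorL2 :=
  matrixAction.holderL volume ∞ 2 2 h.memLp_top.toLp

lemma coeFn_mulCLM (h : IsPotential V) (u : SpinorL2) : h.mulCLM u =ᵐ[volume] mulFun V u := by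
  filter_upwards [matrixAction.coeFn_holder (r := 2) h.memLp_top.toLp u,
    h.memLp_top.coeFn_toLp] with x hmul hV
  exact hmul.trans (by rw [hV]; rfl)

lemma memLp_mulFun (h : IsPotential V) (u : SpinorL2) : MemLp (mulFun V u) 2 :=
  (memLp_congr_ae (h.coeFn_mulCLM u)).1 (Lp.memLp _)

lemma mulOp_apply (h : IsPotential V) (u : (mulOp V).domain) : mulOp V u = h.mulCLM u :=
  Lp.ext ((MemLp.coeFn_toLp u.2).trans (h.coeFn_mulCLM u).symm)

lemma inner_mulCLM_left (h : IsPotential V) (u v : SpinorL2) :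
    inner ℂ (h.mulCLM u) v = inner ℂ u (h.conjTranspose.mulCLM v) := by
  rw [L2.inner_def, L2.inner_def]
  refine integral_congr_ae ?_
  filter_upwards [h.coeFn_mulCLM u, h.conjTranspose.coeFn_mulCLM v] with x hu hv
  rw [hu, hv]
  exact inner_toEuclideanCLM_left _ _ _

lemma norm_mulCLM_le (h : IsPotential V) {u : SpinorL2} {S : ℝ} (hu : ∀ᵐ x, ‖u x‖ ≤ S) :
    ‖h.mulCLM u‖ ≤ S * (eLpNorm V 2 volume).toReal := by
  have hV := memLp_two_of_integrable_of_memLp_top h.integrable h.memLp_top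
  rw [← Lp.norm_toLp V hV]
  refine Lp.norm_le_mul_norm_of_ae_le_mul ?_
  filter_upwards [hu, h.coeFn_mulCLM u, hV.coeFn_toLp] with x hu hmul hV
  rw [hmul, hV, mul_comm]
  exact (norm_toEuclideanCLM_le _ _).trans (by gcongr)

end IsPotential

/-! ### The Dirac operator on `H¹` -/

/-- The free Dirac expression `i α g + m β u`, as an operator of the pair `(u, g)` of a spinor and
its derivative. -/
def freeForm (m : ℝ) : SpinorL2 × SpinorL2 →L[ℂ] SpinorL2 :=
  (m : ℂ) • constMatrix beta ∘L .fst ℂ _ _ + Complex.I • constMatrix alpha ∘L .snd ℂ _ _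

lemma freeForm_apply (m : ℝ) (u g : SpinorL2) :
    freeForm m (u, g) = (m : ℂ) • constMatrix beta u + Complex.I • constMatrix alpha g := rfl

/-- The expression `i α g + m β u + V u - z u`; it equals `(H - z) u` when `g` is the derivative
of `u`. -/
def diracForm (m : ℝ) {V : ℝ → Matrix (Fin 2) (Fin 2) ℂ} (h : IsPotential V) (z : ℂ) :
    SpinorL2 × SpinorL2 →L[ℂ] SpinorL2 :=
  freeForm m + (h.mulCLM - z • ContinuousLinearMap.id ℂ _) ∘L .fst ℂ _ _

lemma HasDistribDeriv.inner_eq_neg {u v g h : SpinorL2} (hu : HasDistribDeriv u g)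
    (hv : HasDistribDeriv v h) : inner ℂ u h = -inner ℂ g v := by
  obtain ⟨φ, hφ, hφ'⟩ := hu.exists_schwartz_tendsto
  obtain ⟨χ, hχ, hχ'⟩ := hv.exists_schwartz_tendsto
  exact tendsto_nhds_unique (hφ.inner hχ')
    ((hφ'.inner hχ).neg.congr fun n => (inner_toL2_lineDerivOp _ _).symm)

lemma inner_freeForm_left (m : ℝ) (u g w : SpinorL2) :
    inner ℂ (freeForm m (u, g)) w =
      inner ℂ g (-Complex.I • constMatrix alpha w) + inner ℂ u (freeForm m (w, 0)) := by
  rw [freeForm_apply, freeForm_apply, map_zero, smul_zero, add_zero, inner_add_left,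
    inner_smul_left, inner_smul_left, inner_constMatrix_left, inner_constMatrix_left,
    conjTranspose_alpha, conjTranspose_beta, inner_smul_right, inner_smul_right, Complex.conj_I,
    Complex.conj_ofReal, add_comm]

lemma im_inner_freeForm_self {m : ℝ} {u g : SpinorL2} (h : HasDistribDeriv u g) :
    (inner ℂ u (freeForm m (u, g))).im = 0 := by
  refine Complex.conj_eq_iff_im.1 ?_
  rw [inner_conj_symm, inner_freeForm_left]
  simp only [freeForm_apply, map_zero, smul_zero, add_zero, inner_add_right, inner_smul_right,
    h.inner_eq_neg (h.constMatrix alpha)]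
  ring

lemma abs_im_mul_norm_le {m : ℝ} {u g : SpinorL2} (h : HasDistribDeriv u g) (z : ℂ) :
    |z.im| * ‖u‖ ≤ ‖freeForm m (u, g) - z • u‖ := by
  have im_inner : (inner ℂ u (freeForm m (u, g) - z • u)).im = -(z.im * ‖u‖ ^ 2) := by
    rw [inner_sub_right, Complex.sub_im, im_inner_freeForm_self h, inner_smul_right,
      inner_self_eq_norm_sq_to_K]
    simp [← Complex.ofReal_pow]
  have le_mul := (Complex.abs_im_le_norm _).trans
    (norm_inner_le_norm (𝕜 := ℂ) u (freeForm m (u, g) - z • u))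
  rw [im_inner, abs_neg, abs_mul, abs_of_nonneg (sq_nonneg ‖u‖)] at le_mul
  rcases (norm_nonneg u).eq_or_lt with h0 | h0
  · rw [← h0, mul_zero]
    exact norm_nonneg _
  · nlinarith

section Potential

variable {m : ℝ} {V : ℝ → Matrix (Fin 2) (Fin 2) ℂ}

lemma diracForm_apply (h : IsPotential V) (z : ℂ) (u g : SpinorL2) :
    diracForm m h z (u, g) = freeForm m (u, g) + h.mulCLM u - z • u :=
  (add_sub_assoc _ _ _).symm

lemma diracForm_eq_add (h : IsPotential V) (z : ℂ) (u g : SpinorL2) :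
    diracForm m h z (u, g) = diracForm m h z (u, 0) + Complex.I • constMatrix alpha g := by
  simp only [diracForm_apply, freeForm_apply, map_zero, smul_zero]
  abel

lemma coeFn_diracForm_toL2 (h : IsPotential V) (z : ℂ) (φ : 𝓢(ℝ, Spinor)) :
    diracForm m h z (toL2 φ, toL2 (∂_{(1 : ℝ)} φ)) =ᵐ[volume] diracExpr m V z φ := by
  set φ' := ∂_{(1 : ℝ)} φ with hφ'
  filter_upwards [Lp.coeFn_sub (freeForm m (toL2 φ, toL2 φ') + h.mulCLM (toL2 φ)) (z • toL2 φ),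
    Lp.coeFn_add (freeForm m (toL2 φ, toL2 φ')) (h.mulCLM (toL2 φ)),
    Lp.coeFn_add ((m : ℂ) • constMatrix beta (toL2 φ)) (Complex.I • constMatrix alpha (toL2 φ')),
    Lp.coeFn_smul (m : ℂ) (constMatrix beta (toL2 φ)),
    Lp.coeFn_smul Complex.I (constMatrix alpha (toL2 φ')), Lp.coeFn_smul z (toL2 φ),
    coeFn_toL2 φ, coeFn_toL2 φ', coeFn_constMatrix beta (toL2 φ),
    coeFn_constMatrix alpha (toL2 φ'), h.coeFn_mulCLM (toL2 φ)]
    with x hsub hadd hfree hmβ hIα hz hφx hφ'x hβ hα hV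
  have deriv_eq : deriv φ x = φ' x := by
    rw [hφ', SchwartzMap.lineDerivOp_apply_eq_fderiv, fderiv_apply_one_eq_deriv]
  rw [diracForm_apply, hsub, Pi.sub_apply, hadd, Pi.add_apply, freeForm_apply, hfree,
    Pi.add_apply, hmβ, Pi.smul_apply, hIα, Pi.smul_apply, hz, Pi.smul_apply, hβ, hα, hV, mulFun,
    hφx, hφ'x, diracExpr, deriv_eq]
  simp only [map_smul, map_add, map_sub, map_one, add_apply, sub_apply, smul_apply]
  abel

lemma mem_domain_dirac (h : IsPotential V) {u : SpinorL2} :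
    u ∈ (dirac m V).domain ↔ ∃ g, HasDistribDeriv u g :=
  ⟨fun hu => hu.1, fun hu => ⟨hu, h.memLp_mulFun u⟩⟩

lemma dirac_sub_smul_eq (h : IsPotential V) (z : ℂ) {u g : SpinorL2} (hg : HasDistribDeriv u g)
    (hu : u ∈ (dirac m V).domain) :
    dirac m V ⟨u, hu⟩ - z • u = diracForm m h z (u, g) := by
  have derivOp_eq : derivOp ⟨u, hu.1⟩ = g := hu.1.choose_spec.unique hg
  rw [diracForm_apply, freeForm_apply, ← derivOp_eq, ← h.mulOp_apply ⟨u, hu.2⟩]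
  rfl

/-! ### A priori estimates -/

lemma exists_norm_le_of_diracForm (m : ℝ) (h : IsPotential V) :
    ∃ R C : ℝ, 0 ≤ C ∧ ∀ z : ℂ, z.im ≠ 0 → R ≤ ‖z‖ → ∀ (u g : SpinorL2) (N : ℝ),
      HasDistribDeriv u g → HasDampedBound |z.im| (diracForm m h z (u, g)) N →
        ∀ᵐ x, ‖u x‖ ≤ C * N := by
  obtain ⟨R, C, hC, sup_bound⟩ := exists_norm_le_of_diracExpr m h.integrable
  refine ⟨R, C, hC, fun z hz hzR u g N hug hN => ?_⟩
  obtain ⟨φ, hφ, hφ'⟩ := hug.exists_schwartz_tendsto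
  set f := diracForm m h z (u, g)
  set f' : ℕ → SpinorL2 := fun n => diracForm m h z (toL2 (φ n), toL2 (∂_{(1 : ℝ)} (φ n)))
  have hf' : Tendsto f' atTop (𝓝 f) :=
    ((diracForm m h z).continuous.tendsto (u, g)).comp (hφ.prodMk_nhds hφ')
  have damped (n : ℕ) : HasDampedBound |z.im| (diracExpr m V z (φ n))
      (N + ‖f' n - f‖ / √|z.im|) := by
    have hsum := hN.add (.of_memLp_two (abs_pos.2 hz) (Lp.memLp (f' n - f)))
    rw [← Lp.norm_def] at hsum
    have expr_eq : (fun x => f x + (f' n - f : SpinorL2) x) =ᵐ[volume] diracExpr m V z (φ n) := by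
      filter_upwards [Lp.coeFn_sub (f' n) f, coeFn_diracForm_toL2 h z (φ n)] with x hsub hx
      rw [hsub, Pi.sub_apply, add_sub_cancel, hx]
    simpa only [one_mul] using hsum.of_norm_le (hsum.aestronglyMeasurable.congr expr_eq)
      zero_le_one (expr_eq.mono fun x hx => by rw [← hx, one_mul])
  have approx_bound (n : ℕ) (x : ℝ) : ‖φ n x‖ ≤ C * (N + ‖f' n - f‖ / √|z.im|) :=
    sup_bound z hz hzR _ _ _ (φ n).differentiable
      (φ n).toBoundedContinuousFunction.norm_coe_le_norm (damped n) x
  have bound_tendsto : Tendsto (fun n => C * (N + ‖f' n - f‖ / √|z.im|)) atTop (𝓝 (C * N)) := by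
    simpa using (((hf'.sub_const f).norm.div_const √|z.im|).const_add N).const_mul C
  obtain ⟨ns, hns, ae_tendsto⟩ := (tendstoInMeasure_of_tendsto_Lp hφ).exists_seq_tendsto_ae
  filter_upwards [ae_tendsto, ae_all_iff.2 fun n => coeFn_toL2 (φ n)] with x hx coe_eq
  refine le_of_tendsto_of_tendsto' hx.norm (bound_tendsto.comp hns.tendsto_atTop) fun n => ?_
  rw [coe_eq]
  exact approx_bound _ x

lemma exists_norm_le_mul_norm_diracForm (m : ℝ) (h : IsPotential V) :
    ∃ R : ℝ, ∀ z : ℂ, z.im ≠ 0 → R ≤ ‖z‖ → ∃ C : ℝ, ∀ u g : SpinorL2, HasDistribDeriv u g →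
      ‖u‖ ≤ C * ‖diracForm m h z (u, g)‖ := by
  obtain ⟨R, C, -, sup_bound⟩ := exists_norm_le_of_diracForm m h
  refine ⟨R, fun z hz hzR => ?_⟩
  have him : 0 < |z.im| := abs_pos.2 hz
  set v := (eLpNorm V 2 volume).toReal
  refine ⟨(1 + C / √|z.im| * v) / |z.im|, fun u g hug => ?_⟩
  set f := diracForm m h z (u, g) with hf
  have damped : HasDampedBound |z.im| f (‖f‖ / √|z.im|) := .of_memLp_two him (Lp.memLp f)
  have potential_bound : ‖h.mulCLM u‖ ≤ C * (‖f‖ / √|z.im|) * v :=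
    h.norm_mulCLM_le (sup_bound z hz hzR u g _ hug damped)
  have free_eq : freeForm m (u, g) - z • u = f - h.mulCLM u := by
    rw [hf, diracForm_apply]
    abel
  rw [div_mul_eq_mul_div, le_div_iff₀ him]
  calc ‖u‖ * |z.im| = |z.im| * ‖u‖ := mul_comm _ _
    _ ≤ ‖f - h.mulCLM u‖ := free_eq ▸ abs_im_mul_norm_le hug z
    _ ≤ ‖f‖ + ‖h.mulCLM u‖ := norm_sub_le _ _
    _ ≤ ‖f‖ + C * (‖f‖ / √|z.im|) * v := by gcongr
    _ = (1 + C / √|z.im| * v) * ‖f‖ := by ring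

end Potential

/-! ### The resolvent -/

section Potential

variable {m : ℝ} {V : ℝ → Matrix (Fin 2) (Fin 2) ℂ}

/-- The operator `H - z` on the core of Schwartz functions. -/
def schwartzDirac (m : ℝ) (h : IsPotential V) (z : ℂ) : 𝓢(ℝ, Spinor) →L[ℂ] SpinorL2 :=
  diracForm m h z ∘L
    toL2.prod (toL2 ∘L LineDeriv.lineDerivOpCLM ℂ 𝓢(ℝ, Spinor) (1 : ℝ))

lemma schwartzDirac_apply (h : IsPotential V) (z : ℂ) (φ : 𝓢(ℝ, Spinor)) :
    schwartzDirac m h z φ = diracForm m h z (toL2 φ, toL2 (∂_{(1 : ℝ)} φ)) := rfl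

lemma inner_diracForm_left (h : IsPotential V) (z : ℂ) (u g w : SpinorL2) :
    inner ℂ (diracForm m h z (u, g)) w = inner ℂ g (-Complex.I • constMatrix alpha w) +
      inner ℂ u (diracForm m h.conjTranspose (starRingEnd ℂ z) (w, 0)) := by
  rw [diracForm_apply, diracForm_apply, inner_sub_left, inner_add_left, inner_freeForm_left,
    h.inner_mulCLM_left, inner_smul_left, inner_sub_right, inner_add_right,
    inner_smul_right _ _ (starRingEnd ℂ z)]
  ring

lemma hasDistribDeriv_of_mem_orthogonal_range (h : IsPotential V) {z : ℂ} {w : SpinorL2}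
    (hw : w ∈ (schwartzDirac m h z).toLinearMap.rangeᗮ) :
    HasDistribDeriv w
      (Complex.I • constMatrix alpha (diracForm m h.conjTranspose (starRingEnd ℂ z) (w, 0))) := by
  have deriv_alpha : HasDistribDeriv (-Complex.I • constMatrix alpha w)
      (diracForm m h.conjTranspose (starRingEnd ℂ z) (w, 0)) := by
    refine hasDistribDeriv_of_inner fun χ => ?_
    have orthogonal : inner ℂ (schwartzDirac m h z χ) w = 0 :=
      (Submodule.mem_orthogonal _ _).1 hw _ ⟨χ, rfl⟩
    rw [schwartzDirac_apply, inner_diracForm_left] at orthogonal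
    exact eq_neg_of_add_eq_zero_left orthogonal
  have w_eq : Complex.I • constMatrix alpha (-Complex.I • constMatrix alpha w) = w := by
    rw [map_smul, constMatrix_alpha_constMatrix_alpha, smul_smul]
    simp
  simpa only [w_eq] using (deriv_alpha.constMatrix alpha).smul Complex.I

lemma denseRange_schwartzDirac (h : IsPotential V) {z : ℂ}
    (adjoint_injective : ∀ u g : SpinorL2, HasDistribDeriv u g →
      diracForm m h.conjTranspose (starRingEnd ℂ z) (u, g) = 0 → u = 0) :
    DenseRange (schwartzDirac m h z) := by
  have closure_eq_top : (schwartzDirac m h z).toLinearMap.range.topologicalClosure = ⊤ := by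
    refine Submodule.topologicalClosure_eq_top_iff.2 ((Submodule.eq_bot_iff _).2 fun w hw => ?_)
    refine adjoint_injective w _ (hasDistribDeriv_of_mem_orthogonal_range h hw) ?_
    rw [diracForm_eq_add, map_smul, constMatrix_alpha_constMatrix_alpha, smul_smul,
      Complex.I_mul_I, neg_one_smul, add_neg_cancel]
  exact (Submodule.dense_iff_topologicalClosure_eq_top.2 closure_eq_top : _)

lemma exists_diracForm_eq (h : IsPotential V) {z : ℂ} {C : ℝ}
    (lower_bound : ∀ u g : SpinorL2, HasDistribDeriv u g → ‖u‖ ≤ C * ‖diracForm m h z (u, g)‖)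
    (hT : DenseRange (schwartzDirac m h z)) (f : SpinorL2) :
    ∃ u g : SpinorL2, HasDistribDeriv u g ∧ diracForm m h z (u, g) = f := by
  obtain ⟨φ, u, hf, hu⟩ := exists_seq_tendsto_of_denseRange (schwartzDirac m h z) toL2
    (fun φ => lower_bound _ _ (hasDistribDeriv_toL2 φ)) hT f
  -- the equation recovers the derivative of `u` from `u` and `(H - z) u`
  have deriv_eq (n : ℕ) : -Complex.I • constMatrix alpha
      (schwartzDirac m h z (φ n) - diracForm m h z (toL2 (φ n), 0)) =
        toL2 (∂_{(1 : ℝ)} (φ n)) := by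
    rw [schwartzDirac_apply, diracForm_eq_add, add_sub_cancel_left, map_smul,
      constMatrix_alpha_constMatrix_alpha, smul_smul]
    simp
  have hu₀ : Tendsto (fun n => diracForm m h z (toL2 (φ n), 0)) atTop
      (𝓝 (diracForm m h z (u, 0))) :=
    ((diracForm m h z).continuous.tendsto _).comp (hu.prodMk_nhds tendsto_const_nhds)
  have hg := ((((constMatrix alpha).continuous.tendsto _).comp (hf.sub hu₀)).const_smul
    (-Complex.I)).congr deriv_eq
  exact ⟨u, _, .of_tendsto (fun n => hasDistribDeriv_toL2 (φ n)) hu hg,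
    tendsto_nhds_unique (((diracForm m h z).continuous.tendsto _).comp (hu.prodMk_nhds hg)) hf⟩

lemma exists_isResolvent {E : Type*} [NormedAddCommGroup E] [NormedSpace ℂ E]
    (A : E →ₗ.[ℂ] E) (z : ℂ) {C : ℝ}
    (lower_bound : ∀ u : A.domain, ‖(u : E)‖ ≤ C * ‖A u - z • (u : E)‖)
    (surjective : ∀ f, ∃ u : A.domain, A u - z • (u : E) = f) :
    ∃ R : E →L[ℂ] E, IsResolvent A z R := by
  let T : A.domain →ₗ[ℂ] E := A.toFun - z • A.domain.subtype
  have injective : Function.Injective T := by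
    refine (injective_iff_map_eq_zero T).2 fun u hu => ?_
    have u_bound : ‖(u : E)‖ ≤ C * ‖T u‖ := lower_bound u
    rw [hu, norm_zero, mul_zero] at u_bound
    exact Subtype.ext (norm_le_zero_iff.1 u_bound)
  let e : A.domain ≃ₗ[ℂ] E := LinearEquiv.ofBijective T ⟨injective, surjective⟩
  have right_inv (f : E) : A (e.symm f) - z • (e.symm f : E) = f := e.apply_symm_apply f
  let R : E →L[ℂ] E := (A.domain.subtype ∘ₗ e.symm.toLinearMap).mkContinuous C fun f =>
    (lower_bound (e.symm f)).trans_eq (by rw [right_inv])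
  exact ⟨R, fun f => (e.symm f).2, right_inv,
    fun u => congrArg Subtype.val (e.symm_apply_apply u)⟩

lemma exists_forall_isResolvent_dirac (m : ℝ) (h : IsPotential V) :
    ∃ R₀ : ℝ, ∀ z : ℂ, z.im ≠ 0 → R₀ ≤ ‖z‖ →
      ∃ R : SpinorL2 →L[ℂ] SpinorL2, IsResolvent (dirac m V) z R := by
  obtain ⟨R₁, lower_bound⟩ := exists_norm_le_mul_norm_diracForm m h
  obtain ⟨R₂, adjoint_lower_bound⟩ := exists_norm_le_mul_norm_diracForm m h.conjTranspose
  refine ⟨max R₁ R₂, fun z hz hzR => ?_⟩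
  obtain ⟨C, hC⟩ := lower_bound z hz ((le_max_left _ _).trans hzR)
  obtain ⟨C', hC'⟩ := adjoint_lower_bound (starRingEnd ℂ z) (by simpa using hz)
    ((le_max_right _ _).trans (hzR.trans_eq (Complex.norm_conj z).symm))
  have dense : DenseRange (schwartzDirac m h z) := by
    refine denseRange_schwartzDirac h fun u g hug h0 => norm_le_zero_iff.1 ?_
    simpa only [h0, norm_zero, mul_zero] using hC' u g hug
  refine exists_isResolvent _ z (C := C) (fun u => ?_) fun f => ?_
  · obtain ⟨g, hg⟩ := (mem_domain_dirac h).1 u.2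
    rw [dirac_sub_smul_eq h z hg u.2]
    exact hC u g hg
  · obtain ⟨u, g, hug, hf⟩ := exists_diracForm_eq h hC dense f
    exact ⟨⟨u, (mem_domain_dirac h).2 ⟨g, hug⟩⟩, (dirac_sub_smul_eq h z hug _).trans hf⟩

end Potential

/-! ### The weighted resolvent estimate -/

lemma bracket_rpow_eq (x r : ℝ) : bracket x ^ r = (1 + ‖x‖ ^ 2) ^ (r / 2) := by
  rw [bracket, Real.sqrt_eq_rpow, ← Real.rpow_mul (by positivity), Real.norm_eq_abs]
  congr 1
  ring

lemma bracket_rpow_nonneg (x r : ℝ) : 0 ≤ bracket x ^ r :=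
  Real.rpow_nonneg (Real.sqrt_nonneg _) r

lemma integrable_bracket_rpow {r : ℝ} (hr : 1 < r) : Integrable fun x => bracket x ^ (-r) := by
  simp only [bracket_rpow_eq]
  exact integrable_rpow_neg_one_add_norm_sq (by simpa using hr)

lemma memLp_two_bracket_rpow {σ : ℝ} (hσ : 1 / 2 < σ) : MemLp (fun x => bracket x ^ (-σ)) 2 := by
  have measurable : Measurable fun x => bracket x ^ (-σ) := by
    unfold bracket
    fun_prop
  refine (memLp_two_iff_integrable_sq measurable.aestronglyMeasurable).2 ?_
  refine (integrable_bracket_rpow (r := 2 * σ) (by linarith)).congr (.of_forall fun x => ?_)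
  simp only [bracket, ← Real.rpow_natCast, ← Real.rpow_mul (Real.sqrt_nonneg _)]
  congr 1
  push_cast
  ring

lemma norm_weight_apply_ae_eq (σ : ℝ) (hσ : 0 ≤ σ) (u : SpinorL2) :
    ∀ᵐ x, ‖weight σ hσ u x‖ = bracket x ^ (-σ) * ‖u x‖ := by
  filter_upwards [ContinuousLinearMap.coeFn_holder (r := 2)
    (ContinuousLinearMap.lsmul ℂ ℂ (E := Spinor)) (memLp_weight σ hσ).toLp u,
    (memLp_weight σ hσ).coeFn_toLp] with x hmul hweight
  rw [weight, ContinuousLinearMap.holderL_apply_apply, hmul, hweight,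
    ContinuousLinearMap.lsmul_apply, norm_smul, Complex.norm_real,
    Real.norm_of_nonneg (bracket_rpow_nonneg _ _)]

section Weighted

variable {σ : ℝ} (hσ : 1 / 2 < σ) (hσ₀ : 0 ≤ σ)
include hσ

lemma integrable_weight (f : SpinorL2) : Integrable (weight σ hσ₀ f) := by
  refine (integrable_norm_iff (Lp.aestronglyMeasurable _)).1 ?_
  exact (integrable_congr (norm_weight_apply_ae_eq σ hσ₀ f)).2
    ((memLp_two_bracket_rpow hσ).integrable_mul (Lp.memLp f).norm)

lemma integral_norm_weight_le (f : SpinorL2) :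
    ∫ x, ‖weight σ hσ₀ f x‖ ≤ (eLpNorm (fun x => bracket x ^ (-σ)) 2 volume).toReal * ‖f‖ := by
  rw [integral_congr_ae (norm_weight_apply_ae_eq σ hσ₀ f), Lp.norm_def]
  simpa only [Real.norm_of_nonneg (bracket_rpow_nonneg _ _)] using
    integral_norm_mul_norm_le (memLp_two_bracket_rpow hσ) (Lp.memLp f)

lemma norm_weight_le {u : SpinorL2} {S : ℝ} (hu : ∀ᵐ x, ‖u x‖ ≤ S) :
    ‖weight σ hσ₀ u‖ ≤ S * (eLpNorm (fun x => bracket x ^ (-σ)) 2 volume).toReal := by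
  have hθ := memLp_two_bracket_rpow hσ
  rw [← Lp.norm_toLp _ hθ]
  refine Lp.norm_le_mul_norm_of_ae_le_mul ?_
  filter_upwards [hu, norm_weight_apply_ae_eq σ hσ₀ u, hθ.coeFn_toLp] with x hS hweight hx
  rw [hweight, hx, Real.norm_of_nonneg (bracket_rpow_nonneg _ _), mul_comm]
  exact mul_le_mul_of_nonneg_right hS (bracket_rpow_nonneg _ _)

end Weighted

section Potential

variable {V : ℝ → Matrix (Fin 2) (Fin 2) ℂ}

lemma exists_norm_weighted_resolvent_le (m : ℝ) (h : IsPotential V) :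
    ∃ R₀ : ℝ, ∀ (σ : ℝ) (hσ₀ : 0 ≤ σ), 1 / 2 < σ → ∃ C : ℝ, ∀ (z : ℂ)
      (R : SpinorL2 →L[ℂ] SpinorL2), z.im ≠ 0 → R₀ ≤ ‖z‖ → IsResolvent (dirac m V) z R →
        ‖weight σ hσ₀ ∘L R ∘L weight σ hσ₀‖ ≤ C := by
  obtain ⟨R₀, K, hK, sup_bound⟩ := exists_norm_le_of_diracForm m h
  refine ⟨R₀, fun σ hσ₀ hσ => ?_⟩
  set Q := (eLpNorm (fun x => bracket x ^ (-σ)) 2 volume).toReal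
  refine ⟨K * Q * Q, fun z R hz hzR hR => ?_⟩
  refine ContinuousLinearMap.opNorm_le_bound _ (by positivity) fun f => ?_
  set w := weight σ hσ₀ f
  obtain ⟨g, hg⟩ := (mem_domain_dirac h).1 (hR.mem_domain w)
  have form_eq : diracForm m h z (R w, g) = w :=
    (dirac_sub_smul_eq h z hg _).symm.trans (hR.right_inv w)
  have damped : HasDampedBound |z.im| (diracForm m h z (R w, g)) (∫ x, ‖w x‖) := by
    rw [form_eq]
    exact .of_integrable (abs_nonneg _) (integrable_weight hσ hσ₀ f)
  calc ‖weight σ hσ₀ (R w)‖ ≤ K * (∫ x, ‖w x‖) * Q :=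
        norm_weight_le hσ hσ₀ (sup_bound z hz hzR _ g _ hg damped)
    _ ≤ K * (Q * ‖f‖) * Q := by
        gcongr
        exact integral_norm_weight_le hσ hσ₀ f
    _ = K * Q * Q * ‖f‖ := by ring

lemma exists_forall_isResolvent_norm_weighted_le (m : ℝ) (h : IsPotential V) :
    ∃ R₀ : ℝ, ∀ (σ : ℝ) (hσ₀ : 0 ≤ σ), 1 / 2 < σ → ∃ C : ℝ, ∀ z : ℂ, z.im ≠ 0 → R₀ ≤ ‖z‖ →
      ∃ R : SpinorL2 →L[ℂ] SpinorL2, IsResolvent (dirac m V) z R ∧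
        ‖weight σ hσ₀ ∘L R ∘L weight σ hσ₀‖ ≤ C := by
  obtain ⟨R₁, exists_resolvent⟩ := exists_forall_isResolvent_dirac m h
  obtain ⟨R₂, weighted_bound⟩ := exists_norm_weighted_resolvent_le m h
  refine ⟨max R₁ R₂, fun σ hσ₀ hσ => ?_⟩
  obtain ⟨C, hC⟩ := weighted_bound σ hσ₀ hσ
  refine ⟨C, fun z hz hzR => ?_⟩
  obtain ⟨R, hR⟩ := exists_resolvent z hz ((le_max_left _ _).trans hzR)
  exact ⟨R, hR, hC z R hz ((le_max_right _ _).trans hzR) hR⟩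

lemma isPotential_of_entries (integrable : ∀ i j, Integrable fun x => V x i j)
    (memLp_top : ∀ i j, MemLp (fun x => V x i j) ∞) : IsPotential V := by
  have eq_sum : V = fun x => ∑ i, ∑ j, V x i j • Matrix.single i j (1 : ℂ) := by
    ext1 x
    simpa only [Matrix.smul_single, smul_eq_mul, mul_one] using Matrix.matrix_eq_sum_single (V x)
  rw [eq_sum]
  exact ⟨integrable_finsetSum _ fun i _ => integrable_finsetSum _ fun j _ =>
      (integrable i j).smul_const _,
    memLp_finsetSum _ fun i _ => memLp_finsetSum _ fun j _ =>
      (memLp_top_const _).smul (memLp_top i j)⟩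

end Potential

lemma integrable_of_norm_le_bracket {f : ℝ → ℂ} (hf : Continuous f) {ε C : ℝ} (hε : 0 < ε)
    (hC : ∀ x, ‖f x‖ ≤ C * bracket x ^ (-1 - ε)) : Integrable f := by
  have dominating : Integrable fun x => C * bracket x ^ (-1 - ε) := by
    rw [← neg_add']
    exact (integrable_bracket_rpow (by linarith)).const_mul C
  exact dominating.mono' hf.aestronglyMeasurable (.of_forall hC)

lemma memLp_top_of_norm_le_bracket {f : ℝ → ℂ} (hf : Continuous f) {ε C : ℝ} (hε : 0 < ε)
    (hC : ∀ x, ‖f x‖ ≤ C * bracket x ^ (-1 - ε)) : MemLp f ∞ := by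
  refine memLp_top_of_bound hf.aestronglyMeasurable |C| (.of_forall fun x => ?_)
  have bracket_le_one : bracket x ^ (-1 - ε) ≤ 1 :=
    Real.rpow_le_one_of_one_le_of_nonpos (one_le_bracket x) (by linarith)
  calc ‖f x‖ ≤ C * bracket x ^ (-1 - ε) := hC x
    _ ≤ |C| * 1 :=
      mul_le_mul (le_abs_self C) bracket_le_one (bracket_rpow_nonneg _ _) (abs_nonneg C)
    _ = |C| := mul_one _

end Dirac1D

end

theorem corollary1p5_general (m : ℝ) (V : ℝ → Matrix (Fin 2) (Fin 2) ℂ)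
    (hVint : ∀ i j, MeasureTheory.Integrable fun x => V x i j)
    (hVbdd : ∀ i j, MeasureTheory.MemLp (fun x => V x i j) ⊤) :
    (∀ (σ : ℝ) (hσ : 1 / 2 < σ), ∃ lam₁ : ℝ, m < lam₁ ∧ ∃ δ : ℝ, 0 < δ ∧ ∃ C : ℝ,
      ∀ lam γ : ℝ, lam₁ < |lam| → 0 < |γ| → |γ| < δ * |lam| →
        ∃ R : Dirac1D.SpinorL2 →L[ℂ] Dirac1D.SpinorL2,
          Dirac1D.IsResolvent (Dirac1D.dirac m V) ((lam : ℂ) + (γ : ℂ) * Complex.I) R ∧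
          ‖Dirac1D.weight σ (by linarith) ∘L R ∘L Dirac1D.weight σ (by linarith)‖ ≤ C) ∧
    ∃ K : Set ℂ, IsCompact K ∧
      ∀ z ∈ Dirac1D.unboundedSpectrum (Dirac1D.dirac m V), z ∉ K → z.im = 0 := by
  obtain ⟨R₀, weighted_bound⟩ := Dirac1D.exists_forall_isResolvent_norm_weighted_le m
    (Dirac1D.isPotential_of_entries hVint hVbdd)
  refine ⟨fun σ hσ => ?_, Metric.closedBall 0 R₀, isCompact_closedBall _ _, fun z hz hzK => ?_⟩
  · obtain ⟨C, hC⟩ := weighted_bound σ (by linarith) hσ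
    refine ⟨max (m + 1) R₀, by simp, 1, one_pos, C, fun lam γ hlam hγ _ => ?_⟩
    refine hC _ (by simpa using hγ) ?_
    calc R₀ ≤ |lam| := (le_max_right _ _).trans hlam.le
      _ = |((lam : ℂ) + γ * Complex.I).re| := by simp
      _ ≤ _ := Complex.abs_re_le_norm _
  · by_contra him
    obtain ⟨_, exists_resolvent⟩ := weighted_bound 1 zero_le_one (by norm_num)
    obtain ⟨R, hR, -⟩ := exists_resolvent z him (by simpa using (not_le.1 (by simpa using hzK)).le)
    exact hz ⟨R, hR⟩

theorem corollary1p5 (m : ℝ) (hm : 0 < m) (V : ℝ → Matrix (Fin 2) (Fin 2) ℂ)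
    (hVcont : ∀ i j, Continuous fun x => V x i j)
    (hVdecay : ∃ ε : ℝ, 0 < ε ∧ ∃ C : ℝ, ∀ x i j,
      ‖V x i j‖ ≤ C * Dirac1D.bracket x ^ (-1 - ε)) :
    (∀ (σ : ℝ) (hσ : 1 / 2 < σ), ∃ lam₁ : ℝ, m < lam₁ ∧ ∃ δ : ℝ, 0 < δ ∧ ∃ C : ℝ,
      ∀ lam γ : ℝ, lam₁ < |lam| → 0 < |γ| → |γ| < δ * |lam| →
        ∃ R : Dirac1D.SpinorL2 →L[ℂ] Dirac1D.SpinorL2,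
          Dirac1D.IsResolvent (Dirac1D.dirac m V) ((lam : ℂ) + (γ : ℂ) * Complex.I) R ∧
          ‖Dirac1D.weight σ (by linarith) ∘L R ∘L Dirac1D.weight σ (by linarith)‖ ≤ C) ∧
    ∃ K : Set ℂ, IsCompact K ∧
      ∀ z ∈ Dirac1D.unboundedSpectrum (Dirac1D.dirac m V), z ∉ K → z.im = 0 := by
  obtain ⟨ε, hε, C, hC⟩ := hVdecay
  exact corollary1p5_general m V
    (fun i j => Dirac1D.integrable_of_norm_le_bracket (hVcont i j) hε fun x => hC x i j)
    fun i j => Dirac1D.memLp_top_of_norm_le_bracket (hVcont i j) hε fun x => hC x i j
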